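/- \textbf{Setting.} Let $F$ be an absolutely continuous probability distribution on $[0,1]$ with mean $m^\varnothing$, let $k\in(0,m^\varnothing)$ be a search cost and $n\ge 1$ a number of brokers. An agent with unit demand searches sequentially, without recall. In each period he pays $k$ and samples a good of unobserved quality $\theta\sim F$ (i.i.d.). Each broker $i$ simultaneously offers a pair $(p_i,G_i)$ of a price $p_i\ge0$ and a posterior-mean distribution $G_i$ that is a mean-preserving contraction of $F$. The agent buys one of these signals, or takes the free uninformative null offer (the point mass at $m^\varnothing$); a posterior mean $m$ is drawn from the chosen distribution and publicly observed; the agent then consumes the good and stops, or continues. Histories record all past offers, purchases and realized posterior means, and the players use (measurable) behavioral strategies. Broker $i$'s payoff is the expected sum of the prices paid to her until search ends; the agent's payoff is the expected quality of the good consumed minus the expected sum of all prices and search costs paid (it is $-\infty$ if the latter is infinite). An equilibrium is a sequentially rational strategy profile: brokers have no profitable deviation after any history, and the agent has none at any of his information sets (including those that follow arbitrary offers in the current period). Let $\mathcal E(n,k)\subseteq\mathbb R^{n+1}_+$ be the set of equilibrium payoff profiles $y$ (coordinate $n+1$ is the agent's), $\|y\|=\sum_j y_j$ the total surplus, $\mathcal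 W(E)=\{\|y\|:y\in E\}$ and $\mathcal A(E)=\{y_{n+1}:y\in E\}$. Let $\underline u_k=m^\varnothing-k$, and let $\bar u_k$ be the solution $u$ of $k=\int_u^1(\theta-u)\,dF(\theta)$. An equilibrium selection rule $y^*$ selects a profile $y^*(n,k)\in\mathcal E(n,k)$ for all $n\ge1$ and $k\in(0,m^\varnothing)$. It is W-symmetric if $\|y^*(n',k)\|=\|y^*(n'',k)\|$ whenever $\mathcal W(\mathcal E(n',k))=\mathcal W(\mathcal E(n'',k))$, and A-symmetric if $y^*_{n'+1}(n',k)=y^*_{n''+1}(n'',k)$ whenever $\mathcal A(\mathcal E(n',k))=\mathcal A(\mathcal E(n'',k))$. \textbf{Statement.} There is a unique $k^*\in(0,m^\varnothing)$ such that for all $n\ge1$: $\mathcal W(\mathcal E(n,k))=[\underline u_k,\bar u_k]$ for all $k\in(0,k^*]$, and $\sup\mathcal W(\mathcal E(n,k))=\inf\mathcal W(\mathcal E(1,k))=\bar u_k$ for all $k\in(k^*,m^\varnothing)$. For this $k^*$ and every $n>1$: 1. (A regulator maximizing total surplus weakly prefers monopoly.) For every equilibrium selection rule $y^*$ and every $k\in(k^*,m^\varnothing)$,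 $\|y^*(1,k)\|\ge\|y^*(n,k)\|$; if $y^*$ is W-symmetric, this holds for all $k\in(0,m^\varnothing)$. 2. (A regulator maximizing the agent's payoff weakly prefers competition.) For every equilibrium selection rule $y^*$ and every $k\in(k^*,m^\varnothing)$, $y^*_{n+1}(n,k)\ge y^*_{2}(1,k)$; if $y^*$ is A-symmetric, this holds for all $k\in(0,m^\varnothing)$. -/

import Mathlib

open MeasureTheory ProbabilityTheory Set
open scoped ENNReal NNReal

namespace PersuadedSearch

noncomputable section

/-- The set of qualities (match values), and of posterior means: `[0,1]`. -/
abbrev Theta : Type := unitInterval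

/-- The prior mean quality. -/
def priorMean (F : Measure Theta) : ℝ := ∫ θ, (θ : ℝ) ∂F

theorem priorMean_mem (F : Measure Theta) [IsProbabilityMeasure F] :
    priorMean F ∈ Set.Icc (0 : ℝ) 1 := by
  have hint : Integrable (fun θ : Theta => (θ : ℝ)) F :=
    Integrable.of_bound (by fun_prop) 1
      (Filter.Eventually.of_forall fun θ => by
        rw [Real.norm_eq_abs, abs_of_nonneg θ.2.1]; exact θ.2.2)
  refine ⟨integral_nonneg fun θ => θ.2.1, ?_⟩
  have h := integral_mono hint (integrable_const (1 : ℝ)) (fun θ : Theta => θ.2.2)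
  simpa [priorMean] using h

/-- The prior mean, as a possible posterior mean. -/
def priorMeanPt (F : Measure Theta) [IsProbabilityMeasure F] : Theta :=
  ⟨priorMean F, priorMean_mem F⟩

/-- `G` is a mean-preserving contraction of `F`: it is below `F` in the convex order.
(The affine functions `x` and `-x` give equality of the means.) -/
def IsMPC (F G : Measure Theta) : Prop :=
  ∀ φ : ℝ → ℝ, ConvexOn ℝ Set.univ φ → ∫ m, φ (m : ℝ) ∂G ≤ ∫ θ, φ (θ : ℝ) ∂F

/-- Signals: the posterior-mean distributions that are feasible under the prior `F`. They carry
the σ-algebra generated by the evaluations `G ↦ G A`. -/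
abbrev Signal (F : Measure Theta) : Type :=
  {G : Measure Theta // IsProbabilityMeasure G ∧ IsMPC F G}

/-- Take-it-or-leave-it offers: a nonnegative price and a signal. -/
abbrev Offer (F : Measure Theta) : Type := ℝ≥0 × Signal F

/-- Profiles of offers of `n` brokers. -/
abbrev Offers (F : Measure Theta) (n : ℕ) : Type := Fin n → Offer F

/-- Purchase decisions: `some i` is Broker `i`'s offer, `none` is the null offer. -/
abbrev Choice (n : ℕ) : Type := Option (Fin n)

instance instMeasurableSpaceChoice (n : ℕ) : MeasurableSpace (Choice n) := ⊤

/-- What a period adds to the public history: offers, purchase decision, realized posterior mean. -/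
abbrev Record (F : Measure Theta) (n : ℕ) : Type := Offers F n × Choice n × Theta

/-- Histories at the beginning of a period that is preceded by `t` periods (so `t = 0` is the
initial period), the agent being still engaged in search. -/
abbrev Hist (F : Measure Theta) (n t : ℕ) : Type := Fin t → Record F n

/-- The price of the offer that is chosen; the null offer is free. -/
def price {F : Measure Theta} {n : ℕ} (O : Offers F n) : Choice n → ℝ≥0
  | none => 0
  | some i => (O i).1

/-- The signal of the offer that is chosen; the null offer is uninformative. -/
def signal {F : Measure Theta} [IsProbabilityMeasure F] {n : ℕ} (O : Offers F n) :
    Choice n → Measure Theta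
  | none => Measure.dirac (priorMeanPt F)
  | some i => (O i).2.1

/-- Behavioral strategies of a broker: after each history, a distribution over offers. -/
structure BrokerStrategy (F : Measure Theta) (n : ℕ) where
  offer : ∀ t : ℕ, Kernel (Hist F n t) (Offer F)
  isMarkov : ∀ t, IsMarkovKernel (offer t)

/-- Behavioral strategies of the agent: a random purchase decision, given the history and the
current offers, and the probability `cont` of continuing to search, given moreover the purchase
decision and the realized posterior mean. -/
structure AgentStrategy (F : Measure Theta) (n : ℕ) where
  buy : ∀ t : ℕ, Kernel (Hist F n t × Offers F n) (Choice n)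
  isMarkov : ∀ t, IsMarkovKernel (buy t)
  cont : ∀ t : ℕ, Hist F n t × Offers F n × Choice n × Theta → ℝ≥0∞
  measurable_cont : ∀ t, Measurable (cont t)
  cont_le_one : ∀ t x, cont t x ≤ 1

/-- Strategy profiles. -/
structure Profile (F : Measure Theta) (n : ℕ) where
  broker : Fin n → BrokerStrategy F n
  agent : AgentStrategy F n

/-- Broker `i` deviates to the strategy `τ`. -/
def Profile.deviateBroker {F : Measure Theta} {n : ℕ} (σ : Profile F n) (i : Fin n)
    (τ : BrokerStrategy F n) : Profile F n :=
  { σ with broker := Function.update σ.broker i τ }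

/-- The agent deviates to the strategy `τ`. -/
def Profile.deviateAgent {F : Measure Theta} {n : ℕ} (σ : Profile F n)
    (τ : AgentStrategy F n) : Profile F n :=
  { σ with agent := τ }

/-- A nonnegative flow that accrues in each period until search ends: it may depend on the offers,
the purchase decision, the realized posterior mean and the probability of continuing. -/
abbrev Flow (F : Measure Theta) (n : ℕ) : Type :=
  Offers F n → Choice n → Theta → ℝ≥0∞ → ℝ≥0∞

section Payoffs

variable {F : Measure Theta} [IsProbabilityMeasure F] {n : ℕ}

/-- Given the expected value `v h'` of what accrues from the next period on (if it is reached with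
history `h'`), the expected value of what accrues from the current period on, seen from the node
where the offers `O` were made after `h`, `w` was purchased and `m` was observed. -/
def valueAtSignal (σ : Profile F n) (g : Flow F n) (t : ℕ) (v : Hist F n (t + 1) → ℝ≥0∞)
    (h : Hist F n t) (O : Offers F n) (w : Choice n) (m : Theta) : ℝ≥0∞ :=
  g O w m (σ.agent.cont t (h, O, w, m)) +
    σ.agent.cont t (h, O, w, m) * v (Fin.snoc (α := fun _ => Record F n) h (O, w, m))

/-- The same, seen from the node where the offers `O` were made after `h`. -/
def valueAtOffers (σ : Profile F n) (g : Flow F n) (t : ℕ) (v : Hist F n (t + 1) → ℝ≥0∞)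
    (h : Hist F n t) (O : Offers F n) : ℝ≥0∞ :=
  ∑ w : Choice n, σ.agent.buy t (h, O) {w} *
    ∫⁻ m, valueAtSignal σ g t v h O w m ∂(signal O w)

/-- The same, seen from the beginning of the period. The brokers randomize independently. -/
def valueAtStart (σ : Profile F n) (g : Flow F n) (t : ℕ) (v : Hist F n (t + 1) → ℝ≥0∞)
    (h : Hist F n t) : ℝ≥0∞ :=
  ∫⁻ O, valueAtOffers σ g t v h O ∂(Measure.pi fun i => (σ.broker i).offer t h)

/-- The expected total flow that accrues, under `σ` and starting from the history `h`, over the next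
`T` periods (or until search ends, if this is earlier). -/
def accrued (σ : Profile F n) (g : Flow F n) : ∀ (_T t : ℕ), Hist F n t → ℝ≥0∞
  | 0, _, _ => 0
  | T + 1, t, h => valueAtStart σ g t (accrued σ g T (t + 1)) h

/-- The expected total flow that accrues until search ends, under `σ` and starting from the history
`h`; by monotone convergence, it is the limit of the truncated expectations. -/
def total (σ : Profile F n) (g : Flow F n) (t : ℕ) (h : Hist F n t) : ℝ≥0∞ :=
  ⨆ T : ℕ, accrued σ g T t h

/-- What Broker `i` earns in a period. -/
def revenue (i : Fin n) : Flow F n := fun O w _ _ => if w = some i then (price O w : ℝ≥0∞) else 0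

/-- What the agent spends in a period: the search cost and the price of the signal. -/
def spending (k : ℝ) : Flow F n := fun O w _ _ => ENNReal.ofReal k + (price O w : ℝ≥0∞)

/-- What the agent consumes, in expectation given the posterior mean `m`, in a period where he
continues with probability `d`. -/
def consumption : Flow F n := fun _ _ m d => ENNReal.ofReal (m : ℝ) * (1 - d)

/-- Broker `i`'s expected payoff, starting from the history `h`. -/
def brokerPayoff (σ : Profile F n) (i : Fin n) (t : ℕ) (h : Hist F n t) : ℝ≥0∞ :=
  total σ (revenue i) t h

/-- The agent's expected payoff, starting from the history `h`. Expected consumption is at most `1`,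
so the difference is well defined; it is `⊥` (that is, `-∞`) if the expected spending is infinite,
for instance if search goes on forever with positive probability. -/
def agentPayoff (k : ℝ) (σ : Profile F n) (t : ℕ) (h : Hist F n t) : EReal :=
  ((total σ consumption t h : ℝ≥0∞) : EReal) - ((total σ (spending k) t h : ℝ≥0∞) : EReal)

/-- The agent's expected payoff, seen from the node where the offers `O` were made after `h`. -/
def agentPayoffAtOffers (k : ℝ) (σ : Profile F n) (t : ℕ) (h : Hist F n t) (O : Offers F n) :
    EReal :=
  ((valueAtOffers σ consumption t (total σ consumption (t + 1)) h O : ℝ≥0∞) : EReal) -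
    ((valueAtOffers σ (spending k) t (total σ (spending k) (t + 1)) h O : ℝ≥0∞) : EReal)

/-- The agent's expected payoff, seen from the node where the offers `O` were made after `h`, `w` was
purchased and `m` was observed. (It includes the sunk search cost and price of the period, which no
strategy affects at this node.) -/
def agentPayoffAtSignal (k : ℝ) (σ : Profile F n) (t : ℕ) (h : Hist F n t) (O : Offers F n)
    (w : Choice n) (m : Theta) : EReal :=
  ((valueAtSignal σ consumption t (total σ consumption (t + 1)) h O w m : ℝ≥0∞) : EReal) -
    ((valueAtSignal σ (spending k) t (total σ (spending k) (t + 1)) h O w m : ℝ≥0∞) : EReal)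

/-- Equilibrium: the strategy profile is sequentially rational. No broker has a profitable deviation
after any history, and the agent has none at any of his information sets, nor at the beginning of
any period. -/
structure IsEquilibrium (k : ℝ) (σ : Profile F n) : Prop where
  broker : ∀ (i : Fin n) (τ : BrokerStrategy F n) (t : ℕ) (h : Hist F n t),
    brokerPayoff (σ.deviateBroker i τ) i t h ≤ brokerPayoff σ i t h
  agent_start : ∀ (τ : AgentStrategy F n) (t : ℕ) (h : Hist F n t),
    agentPayoff k (σ.deviateAgent τ) t h ≤ agentPayoff k σ t h
  agent_buy : ∀ (τ : AgentStrategy F n) (t : ℕ) (h : Hist F n t) (O : Offers F n),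
    agentPayoffAtOffers k (σ.deviateAgent τ) t h O ≤ agentPayoffAtOffers k σ t h O
  agent_stop : ∀ (τ : AgentStrategy F n) (t : ℕ) (h : Hist F n t) (O : Offers F n)
    (w : Choice n) (m : Theta),
    agentPayoffAtSignal k (σ.deviateAgent τ) t h O w m ≤ agentPayoffAtSignal k σ t h O w m

end Payoffs

/-- The set `ℰ(n,k)` of equilibrium payoff profiles: coordinate `i.castSucc` is Broker `i`'s payoff,
the last coordinate is the agent's. -/
def equilibriumPayoffs (F : Measure Theta) [IsProbabilityMeasure F] (n : ℕ) (k : ℝ) :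
    Set (Fin (n + 1) → ℝ) :=
  {y | ∃ σ : Profile F n, IsEquilibrium k σ ∧
    (∀ i : Fin n, ((y i.castSucc : ℝ) : EReal) = (brokerPayoff σ i 0 Fin.elim0 : ℝ≥0∞)) ∧
    ((y (Fin.last n) : ℝ) : EReal) = agentPayoff k σ 0 Fin.elim0}

/-- Total surplus of a payoff profile (its `ℓ¹` norm, equilibrium payoffs being nonnegative). -/
def surplus {n : ℕ} (y : Fin (n + 1) → ℝ) : ℝ := ∑ j, y j

/-- The set `𝒲(E)` of total surpluses of the profiles in `E`. -/
def surplusSet {n : ℕ} (E : Set (Fin (n + 1) → ℝ)) : Set ℝ := surplus '' E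

/-- The set `𝒜(E)` of agent's payoffs of the profiles in `E`. -/
def agentSet {n : ℕ} (E : Set (Fin (n + 1) → ℝ)) : Set ℝ := (fun y => y (Fin.last n)) '' E

/-- The autarky payoff: the agent searches once and consumes without information. -/
def autarky (F : Measure Theta) (k : ℝ) : ℝ := priorMean F - k

/-- `u` is the McCall payoff (that of free and full information): `k = ∫_u^1 (θ - u) dF(θ)`. -/
def IsMcCall (F : Measure Theta) (k u : ℝ) : Prop :=
  k = ∫ θ in {θ : Theta | u ≤ (θ : ℝ)}, ((θ : ℝ) - u) ∂F

/-- `kstar` is the threshold in the search cost: for every number `n ≥ 1` of brokers, all surpluses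
between the autarky and the McCall payoff are equilibrium surpluses when `k ≤ kstar`; when
`k > kstar`, the McCall payoff is the supremum of the equilibrium surpluses under `n` brokers and
the infimum of those under a monopoly. -/
def IsThreshold (F : Measure Theta) [IsProbabilityMeasure F] (kstar : ℝ) : Prop :=
  kstar ∈ Set.Ioo 0 (priorMean F) ∧
  ∀ n : ℕ, 1 ≤ n → ∀ k ∈ Set.Ioo 0 (priorMean F), ∃ ubar : ℝ, IsMcCall F k ubar ∧
    (k ≤ kstar → surplusSet (equilibriumPayoffs F n k) = Set.Icc (autarky F k) ubar) ∧
    (kstar < k → IsLUB (surplusSet (equilibriumPayoffs F n k)) ubar ∧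
      IsGLB (surplusSet (equilibriumPayoffs F 1 k)) ubar)

/-- Equilibrium selection rules: `y n k` is selected from `ℰ(n,k)`, for all market structures. -/
def IsSelectionRule (F : Measure Theta) [IsProbabilityMeasure F]
    (y : (n : ℕ) → ℝ → Fin (n + 1) → ℝ) : Prop :=
  ∀ n : ℕ, 1 ≤ n → ∀ k ∈ Set.Ioo 0 (priorMean F), y n k ∈ equilibriumPayoffs F n k

/-- The same surplus is selected whenever the sets of equilibrium surpluses are the same. -/
def WSymmetric (F : Measure Theta) [IsProbabilityMeasure F]
    (y : (n : ℕ) → ℝ → Fin (n + 1) → ℝ) : Prop :=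
  ∀ n' n'' : ℕ, 1 ≤ n' → 1 ≤ n'' → ∀ k ∈ Set.Ioo 0 (priorMean F),
    surplusSet (equilibriumPayoffs F n' k) = surplusSet (equilibriumPayoffs F n'' k) →
      surplus (y n' k) = surplus (y n'' k)

/-- The same agent's payoff is selected whenever the sets of agent's payoffs are the same. -/
def ASymmetric (F : Measure Theta) [IsProbabilityMeasure F]
    (y : (n : ℕ) → ℝ → Fin (n + 1) → ℝ) : Prop :=
  ∀ n' n'' : ℕ, 1 ≤ n' → 1 ≤ n'' → ∀ k ∈ Set.Ioo 0 (priorMean F),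
    agentSet (equilibriumPayoffs F n' k) = agentSet (equilibriumPayoffs F n'' k) →
      y n' k (Fin.last n') = y n'' k (Fin.last n'')

end

end PersuadedSearch

set_option linter.unusedSectionVars false

/-! Write μ for the prior mean, a = μ - k for the autarky payoff, Φ(x) = E max(θ, x) under F
(`optionValue F x`) and u for the McCall payoff, so that Φ(u) = u + k. Prices are transfers and no
signal is worth more than full information, so total surplus never exceeds u
(`total_consumption_add_revenue_le`); and the agent can always take the null offer and stop, so he
gets at least a after every history. All equilibrium payoffs lie between these bounds, and
everything turns on whether Φ(a) ≤ u, which holds exactly when k is at most a threshold κ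
(`exists_threshold`).

If Φ(a) ≤ u, the agent can be induced to refuse any tempting deviation: refusal is rewarded by the
continuation value u, purchase is punished by a, and even free full information is then worth only
Φ(a). No broker can sell at a positive price, and a lottery between free full information and no
information delivers to the agent any payoff in [a, u] (`threat_mem`). So the sets of surpluses and
of agent's payoffs are both [a, u], whatever the number of brokers.

If Φ(a) > u, such rewards unravel under monopoly. Let W be the supremum of the agent's continuation
values. If W > μ, the monopolist could sell full information at a price x - W with u < x < Φ(a),
even to an agent who is promised W for refusing and a for buying; she then earns x - W everywhere,
and adding the agent's values gives x ≤ u, a contradiction. Hence W ≤ μ and refusal is worth no more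
than μ. Repeated sales of the signal that reveals whether θ < u, just below the indifference price,
then secure almost u - a (`le_brokerPayoff_of_threshold_lt`). So a monopoly has surplus u and leaves
a to the agent: the best surplus and the worst agent's payoff that any market structure can produce.

Optimality of the agent's strategies is verified by dynamic programming. The Bellman inequalities
are stated additively in `ℝ≥0∞`, as consumption against value plus costs, because costs may be
infinite. -/

namespace PersuadedSearch

noncomputable section

/-! ### The option value and the McCall equation -/

section OptionValue

/-- The expected value of the better of a posterior mean drawn from `G` and the outside option `u`. -/
def optionValue (G : Measure Theta) (u : ℝ) : ℝ := ∫ m, max (m : ℝ) u ∂G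

variable {G : Measure Theta} [IsProbabilityMeasure G]

theorem integrable_of_continuous {f : Theta → ℝ} (hf : Continuous f) : Integrable f G := by
  obtain ⟨C, hC⟩ := (isCompact_range hf).isBounded.exists_norm_le
  exact Integrable.of_bound hf.aestronglyMeasurable C
    (Filter.Eventually.of_forall fun θ => hC _ (mem_range_self θ))

theorem integrable_max (u : ℝ) : Integrable (fun m : Theta => max (m : ℝ) u) G :=
  integrable_of_continuous (by fun_prop)

theorem optionValue_mono : Monotone (optionValue G) := fun _ _ h =>
  integral_mono (integrable_max _) (integrable_max _) fun _ => max_le_max le_rfl h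

theorem optionValue_sub_le {x y : ℝ} (h : x ≤ y) :
    optionValue G y - optionValue G x ≤ y - x := by
  have hi : Integrable (fun m : Theta => max (m : ℝ) x + (y - x)) G :=
    (integrable_max x).add (integrable_const _)
  have := integral_mono (integrable_max (G := G) y) hi fun m => by
    simp only
    rcases le_total (m : ℝ) x with h1 | h1 <;> rcases le_total (m : ℝ) y with h2 | h2 <;>
      simp [h1, h2] <;> linarith
  rw [integral_add (integrable_max x) (integrable_const _)] at this
  simp only [integral_const, probReal_univ, smul_eq_mul, one_mul] at this
  unfold optionValue
  linarith

theorem le_optionValue (u : ℝ) : u ≤ optionValue G u := by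
  have := integral_mono (integrable_const u) (integrable_max (G := G) u) fun m => le_max_right _ _
  simpa [optionValue] using this

theorem priorMean_le_optionValue (u : ℝ) : priorMean G ≤ optionValue G u :=
  integral_mono (integrable_of_continuous (by fun_prop)) (integrable_max u) fun _ => le_max_left _ _

theorem optionValue_zero : optionValue G 0 = priorMean G := by
  unfold optionValue priorMean
  congr 1; ext m; exact max_eq_left m.2.1

theorem optionValue_eq_self {u : ℝ} (hu : 1 ≤ u) : optionValue G u = u := by
  have : ∀ m : Theta, max (m : ℝ) u = u := fun m => max_eq_right (m.2.2.trans hu)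
  simp [optionValue, this]

theorem lintegral_ofReal_max {u : ℝ} :
    ∫⁻ m, ENNReal.ofReal (max (m : ℝ) u) ∂G = ENNReal.ofReal (optionValue G u) :=
  (ofReal_integral_eq_lintegral_ofReal (integrable_max u)
    (Filter.Eventually.of_forall fun m => le_max_of_le_left m.2.1)).symm

/-- The excess of the option value over the outside option is strictly decreasing as long as it is
positive. -/
theorem excess_strict {x y : ℝ} (hxy : x < y) (hx : x < optionValue G x) :
    optionValue G y - y < optionValue G x - x := by
  -- At `z`, which is above every posterior mean and above `y`, the excess vanishes. The next
  -- inequality is convexity of `u ↦ max m u - u` on `x < y ≤ z`, with value 0 at `z`.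
  set z := max 1 y with hz
  have hzx : 0 < z - x := by have := le_max_right 1 y; linarith
  have h1 : ∀ m : Theta, (z - x) * (max (m : ℝ) y - y) ≤ (z - y) * (max (m : ℝ) x - x) := by
    intro m
    have hm : (m : ℝ) ≤ z := m.2.2.trans (le_max_left _ _)
    have hy : y ≤ z := le_max_right _ _
    rcases le_total (m : ℝ) y with h2 | h2
    · rw [max_eq_right h2]
      have := le_max_right (m : ℝ) x
      have := mul_nonneg (sub_nonneg.2 hy) (sub_nonneg.2 this)
      simpa using this
    · rw [max_eq_left h2, max_eq_left (hxy.le.trans h2)]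
      nlinarith
  have e : ∀ u, ∫ m : Theta, (max (m : ℝ) u - u) ∂G = optionValue G u - u := fun u => by
    rw [integral_sub (integrable_max u) (integrable_const u)]
    simp [optionValue]
  have h2 := integral_mono (μ := G)
    (((integrable_max y).sub (integrable_const y)).const_mul (z - x))
    (((integrable_max x).sub (integrable_const x)).const_mul (z - y)) h1
  simp only [Pi.sub_apply] at h2
  rw [integral_const_mul, integral_const_mul, e, e] at h2
  have h3 : (z - y) * (optionValue G x - x) < (z - x) * (optionValue G x - x) :=
    mul_lt_mul_of_pos_right (by linarith) (by linarith)
  exact lt_of_mul_lt_mul_left (h2.trans_lt h3) hzx.le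

theorem continuous_optionValue : Continuous (optionValue G) := by
  have : LipschitzWith 1 (optionValue G) := LipschitzWith.of_dist_le_mul fun x y => by
    simp only [NNReal.coe_one, one_mul, Real.dist_eq]
    rcases le_total x y with h | h
    · rw [abs_sub_comm, abs_of_nonneg (sub_nonneg.2 (optionValue_mono h)), abs_sub_comm,
        abs_of_nonneg (sub_nonneg.2 h)]
      exact optionValue_sub_le h
    · rw [abs_of_nonneg (sub_nonneg.2 (optionValue_mono h)), abs_of_nonneg (sub_nonneg.2 h)]
      exact optionValue_sub_le h
  exact this.continuous

theorem setIntegral_sub_eq (u : ℝ) :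
    ∫ θ in {θ : Theta | u ≤ (θ : ℝ)}, ((θ : ℝ) - u) ∂G = optionValue G u - u := by
  have hm : MeasurableSet {θ : Theta | u ≤ (θ : ℝ)} :=
    measurableSet_le measurable_const measurable_subtype_coe
  rw [← integral_indicator hm]
  have e : ∫ m : Theta, (max (m : ℝ) u - u) ∂G = optionValue G u - u := by
    rw [integral_sub (integrable_max u) (integrable_const u)]
    simp [optionValue]
  rw [← e]
  congr 1; ext θ
  by_cases h : u ≤ (θ : ℝ)
  · rw [indicator_of_mem (by exact h), max_eq_left h]
  · rw [indicator_of_notMem (by exact h), max_eq_right (le_of_not_ge h), sub_self]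

theorem isMcCall_iff {k u : ℝ} : IsMcCall G k u ↔ optionValue G u = u + k := by
  rw [IsMcCall, setIntegral_sub_eq]
  constructor <;> intro h <;> linarith

/-- The excess Φ(x) - x is nonincreasing, and strictly decreasing where it is positive, so it
crosses the positive level k only at the McCall payoff. Comparisons with that payoff thus become
inequalities on the excess. -/
theorem le_iff_of_isMcCall {k u x : ℝ} (hk : 0 < k) (hu : IsMcCall G k u) :
    x ≤ u ↔ k ≤ optionValue G x - x := by
  rw [isMcCall_iff] at hu
  constructor
  · intro h
    have := optionValue_sub_le (G := G) h
    linarith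
  · intro h
    by_contra! hlt
    have := excess_strict (G := G) hlt (by linarith)
    linarith

theorem IsMcCall.unique {k u u' : ℝ} (hk : 0 < k) (hu : IsMcCall G k u) (hu' : IsMcCall G k u') :
    u = u' := by
  refine le_antisymm ((le_iff_of_isMcCall hk hu').2 ?_) ((le_iff_of_isMcCall hk hu).2 ?_)
  · rw [isMcCall_iff] at hu; linarith
  · rw [isMcCall_iff] at hu'; linarith

theorem autarky_le_of_isMcCall {k u : ℝ} (hk : 0 < k) (hu : IsMcCall G k u) : autarky G k ≤ u := by
  rw [le_iff_of_isMcCall hk hu]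
  have := priorMean_le_optionValue (G := G) (autarky G k)
  unfold autarky at *
  linarith

theorem IsMcCall.lt_one {k u : ℝ} (hk : 0 < k) (hu : IsMcCall G k u) : u < 1 := by
  by_contra! h
  have := optionValue_eq_self (G := G) h
  rw [isMcCall_iff] at hu
  linarith

theorem exists_isMcCall {k : ℝ} (hk : k ∈ Ioo 0 (priorMean G)) : ∃ u, IsMcCall G k u := by
  have h := intermediate_value_Icc' (f := fun u => optionValue G u - u) zero_le_one
    (continuous_optionValue.sub continuous_id).continuousOn
  have hk' : k ∈ Icc (optionValue G 1 - 1) (optionValue G 0 - 0) := by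
    rw [optionValue_zero, optionValue_eq_self le_rfl]
    exact ⟨by linarith [hk.1], by linarith [hk.2]⟩
  obtain ⟨u, -, hu⟩ := h hk'
  exact ⟨u, isMcCall_iff.2 (by simp only at hu; linarith)⟩

/-- The posterior mean is at least `u` with positive probability if the excess over `u` is. -/
theorem measure_lt_lt_one {u : ℝ} (hu : u < optionValue G u) :
    G {m : Theta | (m : ℝ) < u} < 1 := by
  refine lt_of_le_of_ne prob_le_one fun h => hu.ne' ?_
  have hae : ∀ᵐ m : Theta ∂G, (m : ℝ) < u :=
    (prob_compl_eq_zero_iff (measurableSet_lt measurable_subtype_coe measurable_const)).2 h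
  have : optionValue G u = ∫ _ : Theta, u ∂G :=
    integral_congr_ae (hae.mono fun m hm => max_eq_right (le_of_lt hm))
  simpa using this

end OptionValue

/-! ### The threshold in the search cost -/

section Threshold

variable {F : Measure Theta} [IsProbabilityMeasure F]

theorem measure_singleton_of_absolutelyContinuous (hF : F.AbsolutelyContinuous volume) (x : Theta) :
    F {x} = 0 := hF (measure_singleton x)

/-- Absolute continuity rules out atoms. It enters the whole proof only through this nondegeneracy.
-/
theorem not_ae_eq_const (hF : F.AbsolutelyContinuous volume) (c : ℝ) :
    ¬ ∀ᵐ θ : Theta ∂F, (θ : ℝ) = c := by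
  intro h
  obtain ⟨x, hx⟩ := h.exists
  have : ∀ᵐ θ : Theta ∂F, θ = x := h.mono fun θ hθ => Subtype.ext (hθ.trans hx.symm)
  have h0 : F {x}ᶜ = 0 := this
  have h1 := measure_union_le (μ := F) {x} {x}ᶜ
  rw [union_compl_self, measure_univ, h0, measure_singleton_of_absolutelyContinuous hF] at h1
  simp at h1

theorem ae_le_of_optionValue_eq {u : ℝ} (h : optionValue F u = u) : ∀ᵐ θ : Theta ∂F, (θ : ℝ) ≤ u := by
  have h1 : ∫ m : Theta, (max (m : ℝ) u - u) ∂F = 0 := by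
    rw [integral_sub (integrable_max u) (integrable_const u)]
    simpa [optionValue, sub_eq_zero] using h
  rw [integral_eq_zero_iff_of_nonneg (fun m => sub_nonneg.2 (le_max_right _ _))
    ((integrable_max u).sub (integrable_const u))] at h1
  filter_upwards [h1] with θ hθ
  simp only [Pi.zero_apply] at hθ
  linarith [le_max_left (θ : ℝ) u]

/-- A function that is bounded by its own mean has no room to deviate from it. -/
theorem ae_eq_of_ae_le {f : Theta → ℝ} (hf : Continuous f) {c : ℝ} (h : ∀ᵐ θ ∂F, f θ ≤ c)
    (hc : c ≤ ∫ θ, f θ ∂F) : ∀ᵐ θ ∂F, f θ = c := by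
  have hi := integrable_of_continuous (G := F) hf
  have h0 : ∫ θ, (c - f θ) ∂F = 0 := by
    refine le_antisymm ?_ (integral_nonneg_of_ae (h.mono fun θ hθ => sub_nonneg.2 hθ))
    rw [integral_sub (integrable_const c) hi]
    simpa using hc
  rw [integral_eq_zero_iff_of_nonneg_ae (h.mono fun θ hθ => sub_nonneg.2 hθ)
    ((integrable_const c).sub hi)] at h0
  filter_upwards [h0] with θ hθ
  simp only [Pi.zero_apply] at hθ
  linarith

theorem priorMean_pos (hF : F.AbsolutelyContinuous volume) : 0 < priorMean F := by
  refine lt_of_le_of_ne (priorMean_mem F).1 fun h => not_ae_eq_const hF 0 ?_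
  have := ae_le_of_optionValue_eq (F := F) (u := 0) (by rw [optionValue_zero, ← h])
  exact this.mono fun θ hθ => le_antisymm hθ θ.2.1

theorem priorMean_lt_optionValue (hF : F.AbsolutelyContinuous volume) :
    priorMean F < optionValue F (priorMean F) := by
  refine lt_of_le_of_ne (le_optionValue _) fun h => not_ae_eq_const hF (priorMean F) ?_
  exact ae_eq_of_ae_le (by fun_prop) (ae_le_of_optionValue_eq h.symm) le_rfl

/-- With zero excess at Φ(μ), the variable max(θ, μ) is almost surely at most its mean Φ(μ), hence
equal to it; since Φ(μ) > μ, the quality itself would be constant. This gives the sign at `k = 0` of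
the function whose root is the threshold. -/
theorem excess_optionValue_priorMean_pos (hF : F.AbsolutelyContinuous volume) :
    optionValue F (priorMean F) < optionValue F (optionValue F (priorMean F)) := by
  have hm := priorMean_lt_optionValue hF
  refine lt_of_le_of_ne (le_optionValue _) fun h =>
    not_ae_eq_const hF (optionValue F (priorMean F)) ?_
  have h1 := ae_le_of_optionValue_eq h.symm
  have h2 := ae_eq_of_ae_le (F := F) (f := fun θ => max (θ : ℝ) (priorMean F)) (by fun_prop)
    (h1.mono fun θ hθ => max_le hθ hm.le) le_rfl
  filter_upwards [h2] with θ hθ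
  rcases max_choice (θ : ℝ) (priorMean F) with h3 | h3
  · rw [← hθ, h3]
  · rw [h3] at hθ; exact absurd hθ hm.ne

/-- The threshold: refusing free full information, when the continuation value is that of autarky,
is worth being promised the McCall payoff if and only if the search cost does not exceed it. -/
theorem exists_threshold (hF : F.AbsolutelyContinuous volume) :
    ∃ κ ∈ Ioo 0 (priorMean F), ∀ k ∈ Ioo 0 (priorMean F), ∀ u, IsMcCall F k u →
      (optionValue F (autarky F k) ≤ u ↔ k ≤ κ) := by
  set m := priorMean F with hm
  -- By `le_iff_of_isMcCall` at the point Φ(a), the condition Φ(a) ≤ u amounts to `0 ≤ R k`. The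
  -- threshold is the root of `R`.
  let R : ℝ → ℝ := fun k =>
    optionValue F (optionValue F (m - k)) - optionValue F (m - k) - k
  have hRc : Continuous R := by
    have := continuous_optionValue (G := F)
    fun_prop
  have hR0 : 0 < R 0 := by
    have := excess_optionValue_priorMean_pos hF
    simp only [R, sub_zero]; linarith
  have hRm : R m < 0 := by
    have := excess_strict (G := F) (x := 0) (y := m) (priorMean_pos hF)
      (by rw [optionValue_zero]; exact priorMean_pos hF)
    simp only [R, sub_self, optionValue_zero] at this ⊢
    linarith
  -- In k, Φ(Φ(μ - k)) does not increase, whereas Φ(μ - k) + k strictly increases by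
  -- `excess_strict`.
  have hanti : ∀ a b, 0 ≤ a → a < b → R b < R a := by
    intro a b ha hab
    have h1 : m - b < m - a := by linarith
    have h2 : m - b < optionValue F (m - b) := by
      have := priorMean_le_optionValue (G := F) (m - b)
      linarith
    have h3 := excess_strict (G := F) h1 h2
    have h4 := optionValue_mono (G := F) (optionValue_mono (G := F) h1.le)
    simp only [R]
    linarith
  obtain ⟨κ, hκ, hRκ⟩ := intermediate_value_Icc' (priorMean_pos hF).le hRc.continuousOn
    (show (0 : ℝ) ∈ Icc (R m) (R 0) from ⟨hRm.le, hR0.le⟩)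
  have hκ0 : 0 < κ := lt_of_le_of_ne hκ.1 fun h => by rw [← h] at hRκ; exact hR0.ne' hRκ
  have hκm : κ < m := lt_of_le_of_ne hκ.2 fun h => by rw [h] at hRκ; exact hRm.ne hRκ
  refine ⟨κ, ⟨hκ0, hκm⟩, fun k hk u hu => ?_⟩
  rw [le_iff_of_isMcCall hk.1 hu]
  have : k ≤ optionValue F (optionValue F (autarky F k)) - optionValue F (autarky F k) ↔ 0 ≤ R k := by
    simp only [R, autarky, ← hm]
    constructor <;> intro h <;> linarith
  rw [this]
  constructor
  · intro h
    by_contra! hlt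
    have := hanti κ k hκ0.le hlt
    linarith
  · intro h
    rcases h.lt_or_eq with h | h
    · have := hanti k κ hk.1.le h
      linarith
    · rw [h, hRκ]

end Threshold

/-! ### Binary signals as mean-preserving contractions -/

section Signals

variable {F : Measure Theta} [IsProbabilityMeasure F]

theorem IsMPC.optionValue_le {G : Measure Theta} (h : IsMPC F G) (u : ℝ) :
    optionValue G u ≤ optionValue F u :=
  h (fun x => max x u) ((convexOn_id convex_univ).sup (convexOn_const u convex_univ))

/-- The mean of `F` conditional on `A`. -/
def condMean (F : Measure Theta) (A : Set Theta) : ℝ := ⨍ θ in A, (θ : ℝ) ∂F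

theorem condMean_mem (A : Set Theta) : condMean F A ∈ Icc (0 : ℝ) 1 := by
  unfold condMean
  rw [setAverage_eq]
  -- On a null set the average takes the default value 0, which still lies in the unit interval.
  by_cases hA : F A = 0
  · simp [Measure.real, hA]
  have hr : 0 < F.real A := ENNReal.toReal_pos hA (measure_ne_top _ _)
  have h0 : 0 ≤ ∫ θ in A, (θ : ℝ) ∂F := integral_nonneg fun θ => θ.2.1
  have h1 : ∫ θ in A, (θ : ℝ) ∂F ≤ F.real A := by
    have := integral_mono (μ := F.restrict A)
      (integrable_of_continuous (G := F) (f := fun θ : Theta => (θ : ℝ)) (by fun_prop)).restrict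
      (integrable_const (1 : ℝ)) fun θ => θ.2.2
    simpa using this
  rw [smul_eq_mul, inv_mul_eq_div]
  exact ⟨div_nonneg h0 hr.le, (div_le_one hr).2 h1⟩

def condMeanPt (F : Measure Theta) [IsProbabilityMeasure F] (A : Set Theta) : Theta :=
  ⟨condMean F A, condMean_mem A⟩

theorem measureReal_mul_condMean (A : Set Theta) :
    F.real A * condMean F A = ∫ θ in A, (θ : ℝ) ∂F := by
  have := measure_smul_setAverage (μ := F) (fun θ : Theta => (θ : ℝ)) (s := A) (measure_ne_top _ _)
  simpa [condMean, Measure.real] using this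

/-- Jensen's inequality for the conditional distribution, multiplied by the mass of `A` so that null
sets need no exception. -/
theorem measureReal_mul_map_condMean_le {φ : ℝ → ℝ} (hφ : ConvexOn ℝ univ φ) (A : Set Theta) :
    F.real A * φ (condMean F A) ≤ ∫ θ in A, φ (θ : ℝ) ∂F := by
  have hc : Continuous φ := continuousOn_univ.1 (hφ.continuousOn isOpen_univ)
  by_cases hA : F A = 0
  · simp [Measure.real, hA, Measure.restrict_eq_zero.2 hA]
  have h := hφ.map_set_average_le (μ := F) (t := A) (f := fun θ : Theta => (θ : ℝ))
    hc.continuousOn isClosed_univ hA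
    (measure_ne_top _ _) (by simp) (integrable_of_continuous (by fun_prop)).restrict
    (integrable_of_continuous (G := F) (f := fun θ : Theta => φ θ) (by fun_prop)).restrict
  have h2 := measure_smul_setAverage (μ := F) (fun θ : Theta => φ θ) (s := A) (measure_ne_top _ _)
  rw [← h2, smul_eq_mul]
  exact mul_le_mul_of_nonneg_left h measureReal_nonneg

/-- The signal that reveals whether the quality is in `A`. -/
def binarySignal (F : Measure Theta) [IsProbabilityMeasure F] (A : Set Theta) : Measure Theta :=
  F A • Measure.dirac (condMeanPt F A) + F Aᶜ • Measure.dirac (condMeanPt F Aᶜ)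

theorem isProbabilityMeasure_binarySignal {A : Set Theta} (hA : MeasurableSet A) :
    IsProbabilityMeasure (binarySignal F A) :=
  ⟨by simp [binarySignal, prob_add_prob_compl hA]⟩

theorem integral_binarySignal {A : Set Theta} (f : Theta → ℝ) :
    ∫ m, f m ∂binarySignal F A =
      F.real A * f (condMeanPt F A) + F.real Aᶜ * f (condMeanPt F Aᶜ) := by
  have hi : ∀ B : Set Theta, Integrable f (F B • Measure.dirac (condMeanPt F B)) := fun B =>
    (integrable_dirac (by simp)).smul_measure (measure_ne_top _ _)
  rw [binarySignal, integral_add_measure (hi A) (hi Aᶜ), integral_smul_measure,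
    integral_smul_measure, integral_dirac, integral_dirac]
  rfl

theorem isMPC_binarySignal {A : Set Theta} (hA : MeasurableSet A) :
    IsMPC F (binarySignal F A) := by
  intro φ hφ
  have hc : Continuous φ := continuousOn_univ.1 (hφ.continuousOn isOpen_univ)
  rw [integral_binarySignal (fun m : Theta => φ m), ← integral_add_compl hA
    (integrable_of_continuous (f := fun θ : Theta => φ θ) (by fun_prop))]
  exact add_le_add (measureReal_mul_map_condMean_le hφ A)
    (measureReal_mul_map_condMean_le hφ Aᶜ)

/-- The signal that reveals whether the quality is in `A`, as an element of the set of signals. -/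
def revealing (F : Measure Theta) [IsProbabilityMeasure F] {A : Set Theta} (hA : MeasurableSet A) :
    Signal F :=
  ⟨binarySignal F A, isProbabilityMeasure_binarySignal hA, isMPC_binarySignal hA⟩

/-- The fully informative signal. -/
def fullSignal (F : Measure Theta) [IsProbabilityMeasure F] : Signal F :=
  ⟨F, inferInstance, fun _ _ => le_rfl⟩

/-- The uninformative signal. -/
def nullSignal (F : Measure Theta) [IsProbabilityMeasure F] : Signal F :=
  revealing F MeasurableSet.univ

theorem optionValue_nullSignal (u : ℝ) :
    optionValue (nullSignal F).1 u = max (priorMean F) u := by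
  have h : condMean F univ = priorMean F := by
    have := measureReal_mul_condMean (F := F) univ
    simpa [priorMean] using this
  unfold optionValue nullSignal revealing
  rw [integral_binarySignal (fun m : Theta => max (m : ℝ) u)]
  simp [condMeanPt, h]

end Signals

instance instMeasurableSingletonClassChoice (n : ℕ) : MeasurableSingletonClass (Choice n) :=
  ⟨fun _ => trivial⟩

/-- The lower integral is superadditive without measurability. Value functions are never shown to be
measurable, so the accounting relies on this direction. -/
theorem sum_lintegral_le {α ι : Type*} [MeasurableSpace α] (μ : Measure α) (s : Finset ι)
    (f : ι → α → ℝ≥0∞) : ∑ i ∈ s, ∫⁻ a, f i a ∂μ ≤ ∫⁻ a, ∑ i ∈ s, f i a ∂μ := by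
  classical
  induction s using Finset.induction_on with
  | empty => simp
  | insert i s hi ih =>
    simp only [Finset.sum_insert hi]
    exact (add_le_add le_rfl ih).trans (le_lintegral_add _ _)

/-! ### Accounting identities and bounds on surplus -/

section Accounting

variable {F : Measure Theta} [IsProbabilityMeasure F] {n : ℕ}

instance isProbabilityMeasure_signal (O : Offers F n) (w : Choice n) :
    IsProbabilityMeasure (signal O w) := by
  cases w with
  | none => exact Measure.dirac.isProbabilityMeasure
  | some i => exact (O i).2.2.1

theorem sum_buy (σ : Profile F n) (t : ℕ) (x : Hist F n t × Offers F n) :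
    ∑ w, σ.agent.buy t x {w} = 1 := by
  have := σ.agent.isMarkov t
  simp

/-- The history that is obtained by appending a period. -/
abbrev append {t : ℕ} (h : Hist F n t) (O : Offers F n) (w : Choice n) (m : Theta) :
    Hist F n (t + 1) := Fin.snoc (α := fun _ => Record F n) h (O, w, m)

section Monotone

variable (σ : Profile F n)

theorem valueAtStart_mono {g g' : Flow F n} (hg : ∀ O w m d, g O w m d ≤ g' O w m d) {t : ℕ}
    {v v' : Hist F n (t + 1) → ℝ≥0∞} (hv : ∀ h, v h ≤ v' h) (h : Hist F n t) :
    valueAtStart σ g t v h ≤ valueAtStart σ g' t v' h := by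
  refine lintegral_mono fun O => Finset.sum_le_sum fun w _ => mul_le_mul_right (lintegral_mono
    fun m => ?_) _
  exact add_le_add (hg _ _ _ _) (mul_le_mul_right (hv _) _)

theorem accrued_monotone (g : Flow F n) (t : ℕ) (h : Hist F n t) :
    Monotone fun T => accrued σ g T t h := by
  refine monotone_nat_of_le_succ fun T => ?_
  induction T generalizing t with
  | zero => exact zero_le
  | succ T ih => exact valueAtStart_mono σ (fun _ _ _ _ => le_rfl) (fun h' => ih (t + 1) h') h

/-- Induction on the horizon, with superadditivity of the integral at each node. It serves to bound
search costs plus all revenues by the agent's spending. -/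
theorem sum_accrued_le {ι : Type*} [Fintype ι] {g : ι → Flow F n} {g' : Flow F n}
    (hg : ∀ O w m d, ∑ i, g i O w m d ≤ g' O w m d) (T t : ℕ) (h : Hist F n t) :
    ∑ i, accrued σ (g i) T t h ≤ accrued σ g' T t h := by
  induction T generalizing t with
  | zero => simp [accrued]
  | succ T ih =>
    refine (sum_lintegral_le _ _ _).trans (lintegral_mono fun O => ?_)
    simp only [valueAtOffers]
    rw [Finset.sum_comm]
    refine Finset.sum_le_sum fun w _ => ?_
    rw [← Finset.mul_sum]
    refine mul_le_mul_right ((sum_lintegral_le _ _ _).trans (lintegral_mono fun m => ?_)) _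
    simp only [valueAtSignal, Finset.sum_add_distrib, ← Finset.mul_sum]
    exact add_le_add (hg _ _ _ _) (mul_le_mul_right (ih _ _) _)

theorem sum_total_le {ι : Type*} [Fintype ι] {g : ι → Flow F n} {g' : Flow F n}
    (hg : ∀ O w m d, ∑ i, g i O w m d ≤ g' O w m d) (t : ℕ) (h : Hist F n t) :
    ∑ i, total σ (g i) t h ≤ total σ g' t h := by
  simp only [total]
  rw [ENNReal.finsetSum_iSup_of_monotone fun i => accrued_monotone σ (g i) t h]
  exact iSup_mono fun T => sum_accrued_le σ hg T t h

theorem lintegral_offers_one (t : ℕ) (h : Hist F n t) (x : ℝ≥0∞) :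
    ∫⁻ _, x ∂(Measure.pi fun i => (σ.broker i).offer t h) = x := by
  have := fun i => (σ.broker i).isMarkov t
  simp

theorem valueAtOffers_le {g : Flow F n} {t : ℕ} {v : Hist F n (t + 1) → ℝ≥0∞} {h : Hist F n t}
    {O : Offers F n} {x : ℝ≥0∞}
    (hx : ∀ w, ∫⁻ m, valueAtSignal σ g t v h O w m ∂(signal O w) ≤ x) :
    valueAtOffers σ g t v h O ≤ x := by
  refine (Finset.sum_le_sum fun w _ => mul_le_mul_right (hx w) _).trans ?_
  rw [← Finset.sum_mul, sum_buy, one_mul]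

theorem valueAtSignal_consumption_le {t : ℕ} {v : Hist F n (t + 1) → ℝ≥0∞}
    (hv : ∀ h', v h' ≤ 1) (h : Hist F n t) (O : Offers F n) (w : Choice n) (m : Theta) :
    valueAtSignal σ consumption t v h O w m ≤ 1 := by
  have hd := σ.agent.cont_le_one t (h, O, w, m)
  have hm : ENNReal.ofReal (m : ℝ) ≤ 1 := ENNReal.ofReal_le_one.2 m.2.2
  simp only [valueAtSignal, consumption]
  calc _ ≤ 1 * (1 - σ.agent.cont t (h, O, w, m)) + σ.agent.cont t (h, O, w, m) * 1 :=
        add_le_add (mul_le_mul_left hm _) (mul_le_mul_right (hv _) _)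
    _ = 1 := by rw [one_mul, mul_one, tsub_add_cancel_of_le hd]

theorem lintegral_signal_le_one {O : Offers F n} {w : Choice n} {f : Theta → ℝ≥0∞}
    (hf : ∀ m, f m ≤ 1) : ∫⁻ m, f m ∂(signal O w) ≤ 1 :=
  (lintegral_mono hf).trans (by simp)

theorem valueAtOffers_consumption_le {t : ℕ} {v : Hist F n (t + 1) → ℝ≥0∞}
    (hv : ∀ h', v h' ≤ 1) (h : Hist F n t) (O : Offers F n) :
    valueAtOffers σ consumption t v h O ≤ 1 :=
  valueAtOffers_le σ fun _ =>
    lintegral_signal_le_one fun m => valueAtSignal_consumption_le σ hv h O _ m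

theorem accrued_consumption_le (T t : ℕ) (h : Hist F n t) : accrued σ consumption T t h ≤ 1 := by
  induction T generalizing t with
  | zero => exact zero_le
  | succ T ih =>
    exact (lintegral_mono fun O => valueAtOffers_consumption_le σ (ih _) h O).trans
      (lintegral_offers_one σ t h 1).le

theorem total_consumption_le (t : ℕ) (h : Hist F n t) : total σ consumption t h ≤ 1 :=
  iSup_le fun T => accrued_consumption_le σ T t h

end Monotone

/-- Strategy profiles that agree from period `t` on yield the same continuation values. -/
theorem accrued_congr {σ σ' : Profile F n} (g : Flow F n) (t₀ : ℕ)
    (hb : ∀ i t, t₀ ≤ t → (σ.broker i).offer t = (σ'.broker i).offer t)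
    (hw : ∀ t, t₀ ≤ t → σ.agent.buy t = σ'.agent.buy t)
    (hc : ∀ t, t₀ ≤ t → σ.agent.cont t = σ'.agent.cont t) (T : ℕ) {t : ℕ} (ht : t₀ ≤ t)
    (h : Hist F n t) : accrued σ g T t h = accrued σ' g T t h := by
  induction T generalizing t with
  | zero => rfl
  | succ T ih =>
    have e : accrued σ g T (t + 1) = accrued σ' g T (t + 1) := funext fun h' => ih (by omega) h'
    simp only [accrued, valueAtStart, valueAtOffers, valueAtSignal, e, hw t ht, hc t ht]
    congr 2
    exact funext fun i => by rw [hb i t ht]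

theorem total_congr {σ σ' : Profile F n} (g : Flow F n) (t : ℕ)
    (hb : ∀ i s, t ≤ s → (σ.broker i).offer s = (σ'.broker i).offer s)
    (hw : ∀ s, t ≤ s → σ.agent.buy s = σ'.agent.buy s)
    (hc : ∀ s, t ≤ s → σ.agent.cont s = σ'.agent.cont s) (h : Hist F n t) :
    total σ g t h = total σ' g t h :=
  iSup_congr fun T => accrued_congr g t hb hw hc T le_rfl h

section UpperBound

/-- A flow of costs that consists of the search cost and of an expense for the purchase. -/
def costFlow (k : ℝ) (s : Offers F n → Choice n → ℝ≥0∞) : Flow F n :=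
  fun O w _ _ => ENNReal.ofReal k + s O w

variable (σ : Profile F n) (k : ℝ) (s : Offers F n → Choice n → ℝ≥0∞)

/-- One Bellman step: a random stopping decision averages consumption and continuation, hence does
no better than their maximum. Costs stand on the right, so nothing is subtracted. -/
theorem valueAtSignal_le {t : ℕ} {vC vS : Hist F n (t + 1) → ℝ≥0∞} {x : ℝ≥0∞} {h : Hist F n t}
    {O : Offers F n} {w : Choice n} {m : Theta}
    (hv : vC (append h O w m) ≤ x + vS (append h O w m)) :
    valueAtSignal σ consumption t vC h O w m + (ENNReal.ofReal k + s O w) ≤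
      max (ENNReal.ofReal m) x + valueAtSignal σ (costFlow k s) t vS h O w m := by
  have hd := σ.agent.cont_le_one t (h, O, w, m)
  simp only [valueAtSignal, consumption, costFlow]
  set d := σ.agent.cont t (h, O, w, m)
  set M := max (ENNReal.ofReal m) x
  calc _ ≤ M * (1 - d) + d * (M + vS (append h O w m)) + (ENNReal.ofReal k + s O w) := by
        gcongr
        · exact le_max_left _ _
        · exact hv.trans (add_le_add (le_max_right _ _) le_rfl)
    _ = M * ((1 - d) + d) + (ENNReal.ofReal k + s O w + d * vS (append h O w m)) := by ring
    _ = _ := by rw [tsub_add_cancel_of_le hd, mul_one]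

theorem measurable_max_ofReal (x : ℝ≥0∞) :
    Measurable fun m : Theta => max (ENNReal.ofReal (m : ℝ)) x := by fun_prop

theorem valueAtOffers_add_le {t : ℕ} {vC vS : Hist F n (t + 1) → ℝ≥0∞} {v : Choice n → ℝ≥0∞}
    {B : ℝ≥0∞} {h : Hist F n t} {O : Offers F n} (hs : ∀ w, s O w ≠ ⊤)
    (hv : ∀ w m, vC (append h O w m) ≤ v w + vS (append h O w m))
    (hB : ∀ w, ∫⁻ m, max (ENNReal.ofReal (m : ℝ)) (v w) ∂signal O w ≤ B + s O w) :
    valueAtOffers σ consumption t vC h O + ENNReal.ofReal k ≤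
      B + valueAtOffers σ (costFlow k s) t vS h O := by
  have key : ∀ w, ∫⁻ m, valueAtSignal σ consumption t vC h O w m ∂signal O w + ENNReal.ofReal k ≤
      B + ∫⁻ m, valueAtSignal σ (costFlow k s) t vS h O w m ∂signal O w := by
    intro w
    have h1 := lintegral_mono (μ := signal O w) fun m => valueAtSignal_le σ k s (hv w m)
    rw [lintegral_add_right _ measurable_const, lintegral_add_left (measurable_max_ofReal _)] at h1
    simp only [lintegral_const, measure_univ, mul_one] at h1
    -- The expense was counted on both sides; being finite, it cancels.
    refine (ENNReal.add_le_add_iff_right (hs w)).1 ?_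
    calc _ = _ := add_assoc _ _ _
      _ ≤ _ := h1
      _ ≤ _ := add_le_add (hB w) le_rfl
      _ = _ := by ring
  calc _ = ∑ w, σ.agent.buy t (h, O) {w} *
        (∫⁻ m, valueAtSignal σ consumption t vC h O w m ∂signal O w + ENNReal.ofReal k) := by
        simp only [mul_add, Finset.sum_add_distrib, ← Finset.sum_mul, sum_buy, one_mul]
        rfl
    _ ≤ ∑ w, σ.agent.buy t (h, O) {w} *
        (B + ∫⁻ m, valueAtSignal σ (costFlow k s) t vS h O w m ∂signal O w) :=
        Finset.sum_le_sum fun w _ => mul_le_mul_right (key w) _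
    _ = _ := by
        simp only [mul_add, Finset.sum_add_distrib, ← Finset.sum_mul, sum_buy, one_mul]
        rfl

/-- Whatever strategies are used, consumption is bounded by the costs plus a value function that
satisfies the Bellman inequality. -/
theorem accrued_consumption_le_add {v : Offers F n → Choice n → ℝ≥0∞} {B : Offers F n → ℝ≥0∞}
    {V : ∀ t, Hist F n t → ℝ≥0∞} (hBm : Measurable B) (hs : ∀ O w, s O w ≠ ⊤)
    (hV : ∀ t (h : Hist F n t) O w m, V (t + 1) (append h O w m) ≤ v O w)
    (hB : ∀ O w, ∫⁻ m, max (ENNReal.ofReal (m : ℝ)) (v O w) ∂signal O w ≤ B O + s O w)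
    (hVB : ∀ t (h : Hist F n t), ∫⁻ O, B O ∂(Measure.pi fun i => (σ.broker i).offer t h) ≤
      V t h + ENNReal.ofReal k) (T t : ℕ) (h : Hist F n t) :
    accrued σ consumption T t h ≤ V t h + accrued σ (costFlow k s) T t h := by
  induction T generalizing t with
  -- With no period left, nothing is consumed, so nonnegativity of `V` suffices. The upper bound
  -- needs no transversality condition.
  | zero => exact zero_le
  | succ T ih =>
    have h1 := lintegral_mono (μ := Measure.pi fun i => (σ.broker i).offer t h) fun O =>
      valueAtOffers_add_le σ k s (h := h) (hs O)
        (fun w m => (ih (t + 1) (append h O w m)).trans (add_le_add (hV t h O w m) le_rfl)) (hB O)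
    rw [lintegral_add_right _ measurable_const, lintegral_add_left hBm,
      lintegral_offers_one] at h1
    refine (ENNReal.add_le_add_iff_right (ENNReal.ofReal_ne_top (r := k))).1 ?_
    calc _ ≤ _ := h1
      _ ≤ _ := add_le_add (hVB t h) le_rfl
      _ = _ := add_right_comm _ _ _

theorem total_consumption_le_add {v : Offers F n → Choice n → ℝ≥0∞} {B : Offers F n → ℝ≥0∞}
    {V : ∀ t, Hist F n t → ℝ≥0∞} (hBm : Measurable B) (hs : ∀ O w, s O w ≠ ⊤)
    (hV : ∀ t (h : Hist F n t) O w m, V (t + 1) (append h O w m) ≤ v O w)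
    (hB : ∀ O w, ∫⁻ m, max (ENNReal.ofReal (m : ℝ)) (v O w) ∂signal O w ≤ B O + s O w)
    (hVB : ∀ t (h : Hist F n t), ∫⁻ O, B O ∂(Measure.pi fun i => (σ.broker i).offer t h) ≤
      V t h + ENNReal.ofReal k) (t : ℕ) (h : Hist F n t) :
    total σ consumption t h ≤ V t h + total σ (costFlow k s) t h :=
  iSup_le fun T => (accrued_consumption_le_add σ k s hBm hs hV hB hVB T t h).trans
    (add_le_add le_rfl (le_iSup (fun T => accrued σ (costFlow k s) T t h) T))

end UpperBound

theorem isMPC_signal (O : Offers F n) (w : Choice n) (u : ℝ) :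
    optionValue (signal O w) u ≤ optionValue F u := by
  cases w with
  | none =>
    have : optionValue (signal O none) u = max (priorMean F) u := by
      unfold optionValue
      exact integral_dirac' _ _ (by fun_prop : Continuous fun m : Theta => max (m : ℝ) u).stronglyMeasurable
    rw [this]
    exact max_le (priorMean_le_optionValue u) (le_optionValue u)
  | some i => exact (O i).2.2.2.optionValue_le u

theorem lintegral_max_ofReal {G : Measure Theta} [IsProbabilityMeasure G] (u : ℝ) :
    ∫⁻ m, max (ENNReal.ofReal (m : ℝ)) (ENNReal.ofReal u) ∂G =
      ENNReal.ofReal (optionValue G u) := by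
  rw [← lintegral_ofReal_max]
  exact lintegral_congr fun m => (ENNReal.ofReal_max _ _).symm

/-- The index `none` carries the search cost and `some i` the revenue of Broker `i`: prices are pure
transfers. -/
theorem sum_flows (k : ℝ) (O : Offers F n) (w : Choice n) (m : Theta) (d : ℝ≥0∞) :
    ∑ j : Option (Fin n), (j.elim (costFlow k 0) revenue : Flow F n) O w m d =
      spending k O w m d := by
  rw [Fintype.sum_option]
  simp only [Option.elim, costFlow, revenue, spending, Pi.zero_apply, add_zero]
  congr 1
  cases w with
  | none => simp [price]
  | some j => simp

/-- The total surplus from any history, under any strategy profile, is at most the McCall payoff. -/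
theorem total_consumption_add_revenue_le (σ : Profile F n) {k u : ℝ} (hk : 0 < k) (hu0 : 0 ≤ u)
    (hu : IsMcCall F k u) (t : ℕ) (h : Hist F n t) :
    total σ consumption t h + ∑ i, brokerPayoff σ i t h ≤
      ENNReal.ofReal u + total σ (spending k) t h := by
  -- Prices are left out (`s = 0`). The constant u is then a value function, because a signal with
  -- continuation u is worth at most Φ(u) = u + k.
  have h1 := total_consumption_le_add σ k 0 (v := fun _ _ => ENNReal.ofReal u)
    (B := fun _ => ENNReal.ofReal (u + k)) (V := fun _ _ => ENNReal.ofReal u) measurable_const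
    (by simp) (fun _ _ _ _ _ => le_rfl) (fun O w => by
      rw [lintegral_max_ofReal, ← isMcCall_iff.1 hu]
      exact le_add_right (ENNReal.ofReal_le_ofReal (isMPC_signal O w u)))
    (fun t h => by rw [lintegral_offers_one, ENNReal.ofReal_add hu0 hk.le]) t h
  have h2 := sum_total_le σ (fun O w m d => (sum_flows k O w m d).le) t h
  rw [Fintype.sum_option] at h2
  simp only [Option.elim] at h2
  calc _ ≤ _ := add_le_add h1 le_rfl
    _ = _ := add_assoc _ _ _
    _ ≤ _ := add_le_add le_rfl h2

end Accounting

/-- Only `b`, the spending under the deviation, may be infinite; the left-hand side is then `⊥` and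
both inequalities hold. -/
theorem coe_sub_le_coe_sub_iff {a b c d : ℝ≥0∞} (ha : a ≠ ⊤) (hc : c ≠ ⊤) (hd : d ≠ ⊤) :
    (a : EReal) - b ≤ c - d ↔ a + d ≤ c + b := by
  lift a to ℝ≥0 using ha
  lift c to ℝ≥0 using hc
  lift d to ℝ≥0 using hd
  induction b with
  | top => simp [EReal.coe_ennreal_top, EReal.sub_top]
  | coe b =>
    simp only [EReal.coe_nnreal_eq_coe_real, ← EReal.coe_sub, EReal.coe_le_coe_iff]
    norm_cast
    rw [← NNReal.coe_le_coe]
    push_cast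
    constructor <;> intro h <;> linarith

/-! ### Verification of the agent's stationary strategies -/

section Stationary

variable {F : Measure Theta} {n : ℕ}

/-- The agent's strategy that chooses `sel O` from the offers `O` and stops when the posterior mean
is at least `v O w`, where `w` is the purchase decision. -/
def stationaryAgent (sel : Offers F n → Choice n) (hsel : Measurable sel)
    (v : Offers F n → Choice n → ℝ≥0∞) (hv : ∀ w, Measurable fun O => v O w) :
    AgentStrategy F n where
  buy _ := Kernel.deterministic (fun x => sel x.2) (hsel.comp measurable_snd)
  isMarkov _ := inferInstance
  cont _ x := if v x.2.1 x.2.2.1 ≤ ENNReal.ofReal x.2.2.2 then 0 else 1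
  measurable_cont t := by
    have h1 : Measurable fun y : Offers F n × Choice n => v y.1 y.2 :=
      measurable_from_prod_countable_left hv
    have h2 : Measurable fun x : Hist F n t × Offers F n × Choice n × Theta => v x.2.1 x.2.2.1 :=
      h1.comp (g := fun y : Offers F n × Choice n => v y.1 y.2)
        (f := fun x : Hist F n t × Offers F n × Choice n × Theta => (x.2.1, x.2.2.1)) (by fun_prop)
    exact Measurable.ite (measurableSet_le h2 (by fun_prop)) measurable_const measurable_const
  cont_le_one _ x := by split_ifs <;> simp

/-- The continuation value at the beginning of a period: `v O w` if the last offers were `O` and the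
last purchase decision was `w`. -/
def promised (v₀ : ℝ≥0∞) (v : Offers F n → Choice n → ℝ≥0∞) : ∀ t, Hist F n t → ℝ≥0∞
  | 0, _ => v₀
  | t + 1, h => v (h (Fin.last t)).1 (h (Fin.last t)).2.1

theorem promised_append (v₀ : ℝ≥0∞) (v : Offers F n → Choice n → ℝ≥0∞) {t : ℕ} (h : Hist F n t)
    (O : Offers F n) (w : Choice n) (m : Theta) :
    promised v₀ v (t + 1) (append h O w m) = v O w := by
  simp [promised, append]

variable [IsProbabilityMeasure F]

/-- The conditions under which the stationary strategy is optimal for the agent. -/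
structure IsOptimal (k : ℝ) (β : Fin n → BrokerStrategy F n) (sel : Offers F n → Choice n)
    (v₀ : ℝ≥0∞) (v : Offers F n → Choice n → ℝ≥0∞) (B : Offers F n → ℝ≥0∞) (q : ℝ≥0∞) :
    Prop where
  measurable : Measurable B
  start_le_one : v₀ ≤ 1
  le_one : ∀ O w, v O w ≤ 1
  -- `B O` is the agent's value at the offers `O`, gross of the search cost: `le` says that no
  -- choice is worth more net of its price, `ge` that `sel` attains it.
  le : ∀ O w, ∫⁻ m, max (ENNReal.ofReal (m : ℝ)) (v O w) ∂signal O w ≤ B O + price O w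
  ge : ∀ O, B O + price O (sel O) ≤
    ∫⁻ m, max (ENNReal.ofReal (m : ℝ)) (v O (sel O)) ∂signal O (sel O)
  -- Promise keeping: the brokers' current randomization delivers what the last period promised.
  start : ∀ t h, ∫⁻ O, B O ∂(Measure.pi fun i => (β i).offer t h) =
    promised v₀ v t h + ENNReal.ofReal k
  -- The uniform bound `q < 1` on the probability of continuing makes undelivered promises vanish.
  cont : ∀ t h, ∀ᵐ O ∂(Measure.pi fun i => (β i).offer t h),
    signal O (sel O) {m : Theta | ENNReal.ofReal (m : ℝ) < v O (sel O)} ≤ q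
  lt_one : q < 1

variable {k : ℝ} {β : Fin n → BrokerStrategy F n} {sel : Offers F n → Choice n}
  {hsel : Measurable sel} {v₀ : ℝ≥0∞} {v : Offers F n → Choice n → ℝ≥0∞}
  {hv : ∀ w, Measurable fun O => v O w} {B : Offers F n → ℝ≥0∞} {q : ℝ≥0∞}

theorem valueAtOffers_stationary (g : Flow F n) (t : ℕ) (x : Hist F n (t + 1) → ℝ≥0∞)
    (h : Hist F n t) (O : Offers F n) :
    valueAtOffers ⟨β, stationaryAgent sel hsel v hv⟩ g t x h O =
      ∫⁻ m, valueAtSignal ⟨β, stationaryAgent sel hsel v hv⟩ g t x h O (sel O) m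
        ∂signal O (sel O) := by
  classical
  unfold valueAtOffers
  rw [Finset.sum_eq_single (sel O)]
  · simp [stationaryAgent, Kernel.deterministic_apply]
  · intro w _ hw
    simp only [stationaryAgent, Kernel.deterministic_apply]
    rw [Measure.dirac_apply' _ (measurableSet_singleton w), indicator_of_notMem (by simpa using hw.symm),
      zero_mul]
  · simp

/-- The cutoff rule attains the maximum in `valueAtSignal_le`. The slack `r` in the continuation
matters only if search continues, whence the indicator. -/
theorem le_valueAtSignal_stationary {t : ℕ} {vC vS : Hist F n (t + 1) → ℝ≥0∞} {r : ℝ≥0∞}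
    {h : Hist F n t} {O : Offers F n} {w : Choice n} {m : Theta}
    (hr : v O w + vS (append h O w m) ≤ vC (append h O w m) + r) :
    max (ENNReal.ofReal m) (v O w) +
        valueAtSignal ⟨β, stationaryAgent sel hsel v hv⟩ (spending k) t vS h O w m ≤
      valueAtSignal ⟨β, stationaryAgent sel hsel v hv⟩ consumption t vC h O w m +
        (ENNReal.ofReal k + price O w) +
        r * indicator {m : Theta | ENNReal.ofReal (m : ℝ) < v O w} 1 m := by
  simp only [valueAtSignal, consumption, spending, stationaryAgent]
  split_ifs with hle
  · rw [max_eq_left hle, indicator_of_notMem (by simpa using hle)]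
    simp
  · rw [max_eq_right (le_of_not_ge hle), indicator_of_mem (by simpa using hle)]
    simp only [one_mul, tsub_self, mul_zero, zero_add, Pi.one_apply, mul_one]
    calc _ = (v O w + vS (append h O w m)) + (ENNReal.ofReal k + price O w) := by ring
      _ ≤ _ := add_le_add hr le_rfl
      _ = _ := by ring

namespace IsOptimal

variable (H : IsOptimal k β sel v₀ v B q)

include H

theorem promised_le_one (t : ℕ) (h : Hist F n t) : promised v₀ v t h ≤ 1 := by
  cases t with
  | zero => exact H.start_le_one
  | succ t => exact H.le_one _ _

theorem bound_le_one (O : Offers F n) : B O ≤ 1 :=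
  le_self_add.trans <| (H.ge O).trans <| lintegral_signal_le_one fun m =>
    max_le (ENNReal.ofReal_le_one.2 m.2.2) (H.le_one _ _)

theorem le_valueAtOffers {t : ℕ} {vC vS : Hist F n (t + 1) → ℝ≥0∞} {r : ℝ≥0∞}
    {h : Hist F n t} {O : Offers F n}
    (hr : ∀ w m, v O w + vS (append h O w m) ≤ vC (append h O w m) + r) :
    B O + valueAtOffers ⟨β, stationaryAgent sel hsel v hv⟩ (spending k) t vS h O ≤
      valueAtOffers ⟨β, stationaryAgent sel hsel v hv⟩ consumption t vC h O + ENNReal.ofReal k +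
        r * signal O (sel O) {m : Theta | ENNReal.ofReal (m : ℝ) < v O (sel O)} := by
  have hS : MeasurableSet {m : Theta | ENNReal.ofReal (m : ℝ) < v O (sel O)} :=
    measurableSet_lt (by fun_prop) measurable_const
  have h1 := lintegral_mono (μ := signal O (sel O)) fun m =>
    le_valueAtSignal_stationary (β := β) (hsel := hsel) (hv := hv) (k := k) (hr (sel O) m)
  rw [lintegral_add_left (measurable_max_ofReal _), lintegral_add_right _
    ((measurable_one.indicator hS).const_mul r), lintegral_add_right _ measurable_const,
    lintegral_const_mul _ (measurable_one.indicator hS), lintegral_indicator_one hS,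
    lintegral_const, measure_univ, mul_one] at h1
  rw [valueAtOffers_stationary, valueAtOffers_stationary]
  refine (ENNReal.add_le_add_iff_right (ENNReal.coe_ne_top (r := price O (sel O)))).1 ?_
  calc _ = (B O + price O (sel O)) + _ := add_right_comm _ _ _
    _ ≤ _ := add_le_add (H.ge O) le_rfl
    _ ≤ _ := h1
    _ = _ := by ring

/-- After `T` periods, only agents still searching are owed their promise. They have mass at most `q
^ T`, and promises are at most 1. -/
theorem add_accrued_spending_le (T t : ℕ) (h : Hist F n t) :
    promised v₀ v t h + accrued ⟨β, stationaryAgent sel hsel v hv⟩ (spending k) T t h ≤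
      accrued ⟨β, stationaryAgent sel hsel v hv⟩ consumption T t h + q ^ T := by
  induction T generalizing t with
  | zero => simpa [accrued] using H.promised_le_one t h
  | succ T ih =>
    have h1 := lintegral_mono_ae ((H.cont t h).mono fun O hO =>
      (H.le_valueAtOffers (hsel := hsel) (hv := hv) (h := h) (O := O) (r := q ^ T)
        fun w m => by simpa only [promised_append] using ih (t + 1) (append h O w m)).trans
        (add_le_add le_rfl (mul_le_mul_right hO (q ^ T))))
    have e := lintegral_offers_one ⟨β, stationaryAgent sel hsel v hv⟩ t h
    rw [lintegral_add_left H.measurable, lintegral_add_right _ measurable_const,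
      lintegral_add_right _ measurable_const, e, e, H.start t h, ← pow_succ] at h1
    refine (ENNReal.add_le_add_iff_right (ENNReal.ofReal_ne_top (r := k))).1 ?_
    calc _ = _ := add_right_comm _ _ _
      _ ≤ _ := h1
      _ = _ := add_right_comm _ _ _

theorem add_total_spending_le (t : ℕ) (h : Hist F n t) :
    promised v₀ v t h + total ⟨β, stationaryAgent sel hsel v hv⟩ (spending k) t h ≤
      total ⟨β, stationaryAgent sel hsel v hv⟩ consumption t h := by
  set σ : Profile F n := ⟨β, stationaryAgent sel hsel v hv⟩
  rw [total, ENNReal.add_iSup]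
  -- Spending is kept up to the horizon `T₀` while the horizon of consumption grows, which sends the
  -- error `q ^ T` to 0.
  refine iSup_le fun T₀ => ?_
  have hlim : Filter.Tendsto (fun T : ℕ => total σ consumption t h + q ^ T) Filter.atTop
      (nhds (total σ consumption t h + 0)) :=
    (ENNReal.tendsto_pow_atTop_nhds_zero_of_lt_one H.lt_one).const_add _
  rw [add_zero] at hlim
  refine ge_of_tendsto hlim (Filter.eventually_atTop.2 ⟨T₀, fun T hT => ?_⟩)
  calc _ ≤ promised v₀ v t h + accrued σ (spending k) T t h :=
        add_le_add le_rfl (accrued_monotone σ _ t h hT)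
    _ ≤ accrued σ consumption T t h + q ^ T := H.add_accrued_spending_le T t h
    _ ≤ _ := add_le_add (le_iSup (fun T => accrued σ consumption T t h) T) le_rfl

theorem total_consumption_le (α : AgentStrategy F n) (t : ℕ) (h : Hist F n t) :
    total ⟨β, α⟩ consumption t h ≤ promised v₀ v t h + total ⟨β, α⟩ (spending k) t h :=
  total_consumption_le_add ⟨β, α⟩ k (fun O w => price O w) H.measurable
    (fun _ _ => ENNReal.coe_ne_top) (fun _ _ _ _ _ => (promised_append _ _ _ _ _ _).le) H.le
    (fun t h => (H.start t h).le) t h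

theorem total_consumption_eq (t : ℕ) (h : Hist F n t) :
    total ⟨β, stationaryAgent sel hsel v hv⟩ consumption t h =
      promised v₀ v t h + total ⟨β, stationaryAgent sel hsel v hv⟩ (spending k) t h :=
  (H.total_consumption_le _ t h).antisymm (H.add_total_spending_le t h)

/-- Spending is covered by consumption, which is at most 1. -/
theorem total_spending_ne_top (t : ℕ) (h : Hist F n t) :
    total ⟨β, stationaryAgent sel hsel v hv⟩ (spending k) t h ≠ ⊤ :=
  ne_top_of_le_ne_top ENNReal.one_ne_top <| le_add_self.trans <|
    (H.add_total_spending_le t h).trans (PersuadedSearch.total_consumption_le _ t h)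

theorem agent_start (τ : AgentStrategy F n) (t : ℕ) (h : Hist F n t) :
    agentPayoff k (Profile.deviateAgent ⟨β, stationaryAgent sel hsel v hv⟩ τ) t h ≤
      agentPayoff k ⟨β, stationaryAgent sel hsel v hv⟩ t h := by
  have hC : ∀ σ : Profile F n, total σ consumption t h ≠ ⊤ := fun σ =>
    ne_top_of_le_ne_top ENNReal.one_ne_top (PersuadedSearch.total_consumption_le σ t h)
  refine (coe_sub_le_coe_sub_iff (hC _) (hC _) (H.total_spending_ne_top t h)).2 ?_
  rw [H.total_consumption_eq (hsel := hsel) (hv := hv) t h]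
  calc _ ≤ _ := add_le_add (H.total_consumption_le τ t h) le_rfl
    _ = _ := add_right_comm _ _ _

theorem agent_buy (τ : AgentStrategy F n) (t : ℕ) (h : Hist F n t) (O : Offers F n) :
    agentPayoffAtOffers k (Profile.deviateAgent ⟨β, stationaryAgent sel hsel v hv⟩ τ) t h O ≤
      agentPayoffAtOffers k ⟨β, stationaryAgent sel hsel v hv⟩ t h O := by
  set σ : Profile F n := ⟨β, stationaryAgent sel hsel v hv⟩
  have hC : ∀ σ : Profile F n,
      valueAtOffers σ consumption t (total σ consumption (t + 1)) h O ≤ 1 := fun σ =>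
    valueAtOffers_consumption_le σ (PersuadedSearch.total_consumption_le σ _) h O
  -- Promises made for the next period are kept exactly, so the slack is 0. This is why `O` may be
  -- off the path, where `cont` gives no information.
  have h1 := H.le_valueAtOffers (hsel := hsel) (hv := hv) (h := h) (O := O) (r := 0)
    (vC := total σ consumption (t + 1)) (vS := total σ (spending k) (t + 1))
    fun w m => by
      simpa only [promised_append, add_zero] using H.add_total_spending_le (t + 1) (append h O w m)
  rw [zero_mul, add_zero] at h1
  have h2 := valueAtOffers_add_le (σ.deviateAgent τ) k (fun O w => price O w)
    (vC := total (σ.deviateAgent τ) consumption (t + 1))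
    (vS := total (σ.deviateAgent τ) (spending k) (t + 1)) (h := h) (O := O) (v := v O)
    (fun _ => ENNReal.coe_ne_top)
    (fun w m => by
      have := H.total_consumption_le τ (t + 1) (append h O w m)
      rw [promised_append] at this
      exact this) (H.le O)
  have hS : valueAtOffers σ (spending k) t (total σ (spending k) (t + 1)) h O ≠ ⊤ :=
    ne_top_of_le_ne_top (ENNReal.add_ne_top.2 ⟨ENNReal.one_ne_top, ENNReal.ofReal_ne_top⟩)
      (le_add_self.trans (h1.trans (add_le_add (hC σ) le_rfl)))
  refine (coe_sub_le_coe_sub_iff (ne_top_of_le_ne_top ENNReal.one_ne_top (hC _))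
    (ne_top_of_le_ne_top ENNReal.one_ne_top (hC _)) hS).2 ?_
  have hB : B O ≠ ⊤ := ne_top_of_le_ne_top ENNReal.one_ne_top (H.bound_le_one O)
  -- `h1` and `h2` compare both strategies with `B O`; adding them up and cancelling the finite `B O
  -- + k` eliminates it.
  refine (ENNReal.add_le_add_iff_right (ENNReal.add_ne_top.2
    ⟨hB, ENNReal.ofReal_ne_top (r := k)⟩)).1 ?_
  have h3 := add_le_add h2 h1
  calc _ = _ := by ring
    _ ≤ _ := h3
    _ = _ := by unfold spending costFlow; ring

theorem agent_signal (τ : AgentStrategy F n) (t : ℕ) (h : Hist F n t) (O : Offers F n)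
    (w : Choice n) (m : Theta) :
    agentPayoffAtSignal k (Profile.deviateAgent ⟨β, stationaryAgent sel hsel v hv⟩ τ) t h O w m ≤
      agentPayoffAtSignal k ⟨β, stationaryAgent sel hsel v hv⟩ t h O w m := by
  set σ : Profile F n := ⟨β, stationaryAgent sel hsel v hv⟩
  have hC : ∀ σ : Profile F n,
      valueAtSignal σ consumption t (total σ consumption (t + 1)) h O w m ≤ 1 := fun σ =>
    valueAtSignal_consumption_le σ (PersuadedSearch.total_consumption_le σ _) h O w m
  have h1 := le_valueAtSignal_stationary (β := β) (hsel := hsel) (hv := hv) (k := k)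
    (h := h) (O := O) (w := w) (m := m) (r := 0)
    (vC := total σ consumption (t + 1)) (vS := total σ (spending k) (t + 1)) (by
      simpa only [promised_append, add_zero] using H.add_total_spending_le (t + 1) (append h O w m))
  rw [zero_mul, add_zero] at h1
  have h2 := valueAtSignal_le (σ.deviateAgent τ) k (fun O w => price O w)
    (vC := total (σ.deviateAgent τ) consumption (t + 1))
    (vS := total (σ.deviateAgent τ) (spending k) (t + 1)) (h := h) (O := O) (w := w) (m := m)
    (x := v O w) (by
      have := H.total_consumption_le τ (t + 1) (append h O w m)
      rw [promised_append] at this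
      exact this)
  have hk : ENNReal.ofReal k + (price O w : ℝ≥0∞) ≠ ⊤ :=
    ENNReal.add_ne_top.2 ⟨ENNReal.ofReal_ne_top, ENNReal.coe_ne_top⟩
  have hS : valueAtSignal σ (spending k) t (total σ (spending k) (t + 1)) h O w m ≠ ⊤ :=
    ne_top_of_le_ne_top (ENNReal.add_ne_top.2 ⟨ENNReal.one_ne_top, hk⟩)
      (le_add_self.trans (h1.trans (add_le_add (hC σ) le_rfl)))
  refine (coe_sub_le_coe_sub_iff (ne_top_of_le_ne_top ENNReal.one_ne_top (hC _))
    (ne_top_of_le_ne_top ENNReal.one_ne_top (hC _)) hS).2 ?_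
  have hM : max (ENNReal.ofReal (m : ℝ)) (v O w) ≠ ⊤ := ne_top_of_le_ne_top ENNReal.one_ne_top
    (max_le (ENNReal.ofReal_le_one.2 m.2.2) (H.le_one _ _))
  refine (ENNReal.add_le_add_iff_right (ENNReal.add_ne_top.2 ⟨hM, hk⟩)).1 ?_
  have h3 := add_le_add h2 h1
  calc _ = _ := by ring
    _ ≤ _ := h3
    _ = _ := by unfold spending costFlow; ring

theorem agentPayoff_eq :
    agentPayoff k ⟨β, stationaryAgent sel hsel v hv⟩ 0 Fin.elim0 = ((v₀ : ℝ≥0∞) : EReal) := by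
  have hS := H.total_spending_ne_top (hsel := hsel) (hv := hv) 0 Fin.elim0
  rw [agentPayoff, H.total_consumption_eq]
  simp only [promised]
  have hv₀ : v₀ ≠ ⊤ := ne_top_of_le_ne_top ENNReal.one_ne_top H.start_le_one
  lift v₀ to ℝ≥0 using hv₀
  lift total ⟨β, stationaryAgent sel hsel v hv⟩ (spending k) 0 Fin.elim0 to ℝ≥0 using hS with S
  rw [← ENNReal.coe_add]
  simp only [EReal.coe_nnreal_eq_coe_real, ← EReal.coe_sub]
  rw [NNReal.coe_add, add_sub_cancel_right]

theorem isEquilibrium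
    (hb : ∀ (i : Fin n) (τ : BrokerStrategy F n) (t : ℕ) (h : Hist F n t),
      brokerPayoff (Profile.deviateBroker ⟨β, stationaryAgent sel hsel v hv⟩ i τ) i t h ≤
        brokerPayoff ⟨β, stationaryAgent sel hsel v hv⟩ i t h) :
    IsEquilibrium k ⟨β, stationaryAgent sel hsel v hv⟩ :=
  ⟨hb, H.agent_start, H.agent_buy, H.agent_signal⟩

end IsOptimal

/-! ### Bounds on the brokers' revenue -/

section Revenue

theorem brokerPayoff_eq_zero (i : Fin n)
    (hp : ∀ t (h : Hist F n t), ∀ᵐ O ∂(Measure.pi fun j => (β j).offer t h),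
      sel O = some i → (O i).1 = 0) (t : ℕ) (h : Hist F n t) :
    brokerPayoff ⟨β, stationaryAgent sel hsel v hv⟩ i t h = 0 := by
  refine le_antisymm (iSup_le fun T => ?_) zero_le
  induction T generalizing t with
  | zero => exact zero_le
  | succ T ih =>
    refine (lintegral_mono_ae (g := 0) ((hp t h).mono fun O hO => ?_)).trans (by simp)
    rw [valueAtOffers_stationary]
    refine (lintegral_mono (g := 0) fun m => ?_).trans (by simp)
    have := ih (t + 1) (append h O (sel O) m)
    simp only [valueAtSignal, revenue, Pi.zero_apply]
    rw [le_antisymm this zero_le, mul_zero, add_zero]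
    split_ifs with hs
    · rw [hs]; simp [price, hO hs]
    · exact le_rfl

/-- The constant `Y` is a supersolution of the broker's Bellman equation: a sale yields the price
now and at most `Y` if search continues. The profile `β` is arbitrary, so all deviations are
covered. -/
theorem brokerPayoff_le (i : Fin n) (Y : ℝ≥0∞)
    (hY : ∀ O, sel O = some i → ((O i).1 : ℝ≥0∞) + Y * (O i).2.1
      {m : Theta | ENNReal.ofReal (m : ℝ) < v O (some i)} ≤ Y)
    (t : ℕ) (h : Hist F n t) :
    brokerPayoff ⟨β, stationaryAgent sel hsel v hv⟩ i t h ≤ Y := by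
  refine iSup_le fun T => ?_
  induction T generalizing t with
  | zero => exact zero_le
  | succ T ih =>
    refine (lintegral_mono (g := fun _ => Y) fun O => ?_).trans
      (lintegral_offers_one ⟨β, stationaryAgent sel hsel v hv⟩ t h Y).le
    rw [valueAtOffers_stationary]
    by_cases hs : sel O = some i
    · rw [hs]
      have hS : MeasurableSet {m : Theta | ENNReal.ofReal (m : ℝ) < v O (some i)} :=
        measurableSet_lt (by fun_prop) measurable_const
      refine (lintegral_mono (g := fun m => ((O i).1 : ℝ≥0∞) + Y *
        indicator {m : Theta | ENNReal.ofReal (m : ℝ) < v O (some i)} 1 m) fun m => ?_).trans ?_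
      · have := ih (t + 1) (append h O (some i) m)
        simp only [valueAtSignal, revenue, stationaryAgent, price, if_true]
        refine add_le_add le_rfl ?_
        split_ifs with hle
        · simp
        · have hmem : m ∈ {m : Theta | ENNReal.ofReal (m : ℝ) < v O (some i)} := not_le.1 hle
          rw [indicator_of_mem hmem, one_mul, Pi.one_apply, mul_one]
          exact this
      · rw [lintegral_add_left measurable_const,
          lintegral_const_mul _ (measurable_one.indicator hS), lintegral_indicator_one hS,
          lintegral_const, measure_univ, mul_one]
        exact hY O hs
    · refine (lintegral_mono (g := fun _ => Y) fun m => ?_).trans (by simp)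
      simp only [valueAtSignal, revenue, if_neg hs, zero_add]
      exact (mul_le_of_le_one_left zero_le (AgentStrategy.cont_le_one _ _ _)).trans (ih _ _)

/-- A lower bound on the payoff of a broker whose offers are bought for sure at a price of at least
`p`, search continuing with a probability of at least `q`. -/
theorem le_brokerPayoff (σ : Profile F n) (i : Fin n) {p q c : ℝ≥0∞} (hq : q < 1) (hc : c ≠ ⊤)
    (hcp : c ≤ p + q * c)
    (hσ : ∀ t (h : Hist F n t), ∀ᵐ O ∂(Measure.pi fun j => (σ.broker j).offer t h),
      σ.agent.buy t (h, O) {some i} = 1 ∧ p ≤ (O i).1 ∧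
        q ≤ ∫⁻ m, σ.agent.cont t (h, O, some i, m) ∂(O i).2.1)
    (t : ℕ) (h : Hist F n t) : c ≤ brokerPayoff σ i t h := by
  -- `x T` is what sales at price `p` with continuation probability `q` yield in `T` periods. The
  -- shortfall from `c` contracts by the factor `q` in each period.
  let x : ℕ → ℝ≥0∞ := fun T => Nat.rec 0 (fun _ y => p + q * y) T
  have h1 : ∀ T t h, x T ≤ accrued σ (revenue i) T t h := by
    intro T
    induction T with
    | zero => exact fun _ _ => zero_le
    | succ T ih =>
      intro t h
      rw [← lintegral_offers_one σ t h (x (T + 1))]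
      refine lintegral_mono_ae ((hσ t h).mono fun O ⟨hb, hp, hcont⟩ => ?_)
      refine le_trans ?_ (Finset.single_le_sum (fun _ _ => zero_le) (Finset.mem_univ (some i)))
      rw [hb, one_mul]
      have := (O i).2.2.1
      have hm : Measurable fun m => σ.agent.cont t (h, O, some i, m) :=
        (σ.agent.measurable_cont t).comp (by fun_prop)
      calc x (T + 1) = p + q * x T := rfl
        _ ≤ p + (∫⁻ m, σ.agent.cont t (h, O, some i, m) ∂(O i).2.1) * x T := by gcongr
        _ = ∫⁻ m, (p + σ.agent.cont t (h, O, some i, m) * x T) ∂(O i).2.1 := by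
          rw [lintegral_add_left measurable_const, lintegral_mul_const _ hm]; simp
        _ ≤ _ := lintegral_mono fun m => by
          simp only [valueAtSignal, revenue, price, if_true]
          gcongr
          exact ih _ _
  have h2 : ∀ T, c ≤ x T + c * q ^ T := by
    intro T
    induction T with
    | zero => simp
    | succ T ih =>
      calc c ≤ p + q * c := hcp
        _ ≤ p + q * (x T + c * q ^ T) := by gcongr
        _ = x (T + 1) + c * q ^ (T + 1) := by
          change _ = (p + q * x T) + _
          ring
  have hlim : Filter.Tendsto (fun T : ℕ => brokerPayoff σ i t h + c * q ^ T) Filter.atTop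
      (nhds (brokerPayoff σ i t h + c * 0)) :=
    (ENNReal.Tendsto.const_mul (ENNReal.tendsto_pow_atTop_nhds_zero_of_lt_one hq)
      (Or.inr hc)).const_add _
  rw [mul_zero, add_zero] at hlim
  exact ge_of_tendsto' hlim fun T => (h2 T).trans (add_le_add ((h1 T t h).trans
    (le_iSup (fun T => accrued σ (revenue i) T t h) T)) le_rfl)

end Revenue

end Stationary

/-- Choices are finite in number: comparing them one at a time with the incumbent keeps the
selection measurable. -/
theorem exists_measurable_argmax {α : Type*} [MeasurableSpace α] {n : ℕ} (f : α → Choice n → ℝ≥0∞)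
    (hf : ∀ w, Measurable fun a => f a w) :
    ∃ sel : α → Choice n, Measurable sel ∧ ∀ a w, f a w ≤ f a (sel a) := by
  classical
  suffices h : ∀ s : Finset (Choice n), ∃ sel : α → Choice n, Measurable sel ∧
      ∀ a, ∀ w ∈ s, f a w ≤ f a (sel a) by
    obtain ⟨sel, hm, hs⟩ := h Finset.univ
    exact ⟨sel, hm, fun a w => hs a w (Finset.mem_univ w)⟩
  intro s
  induction s using Finset.induction_on with
  | empty => exact ⟨fun _ => none, measurable_const, by simp⟩
  | insert w s _ ih =>
    obtain ⟨sel, hm, hs⟩ := ih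
    have hv : Measurable fun a => f a (sel a) :=
      (measurable_from_prod_countable_left (f := fun y : α × Choice n => f y.1 y.2) hf).comp
        (measurable_id.prodMk hm)
    refine ⟨fun a => if f a (sel a) ≤ f a w then w else sel a,
      Measurable.ite (measurableSet_le hv (hf w)) measurable_const hm, fun a w' hw' => ?_⟩
    beta_reduce
    split_ifs with hle <;> rcases Finset.mem_insert.1 hw' with rfl | hw'
    · exact le_rfl
    · exact (hs a w' hw').trans hle
    · exact (le_of_not_ge hle)
    · exact hs a w' hw'

/-! ### Measurability and almost sure properties of offers -/

section Offers

variable {F : Measure Theta} {n : ℕ}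

/-- The value of an offer, gross of its price, when the continuation value is `u`. -/
def offerValue (u : ℝ) (o : Offer F) : ℝ≥0∞ :=
  ∫⁻ m, max (ENNReal.ofReal (m : ℝ)) (ENNReal.ofReal u) ∂o.2.1

theorem measurable_offerValue (u : ℝ) : Measurable (offerValue (F := F) u) :=
  (Measure.measurable_lintegral (measurable_max_ofReal _)).comp
    (measurable_subtype_coe.comp measurable_snd)

theorem offerValue_eq (u : ℝ) (o : Offer F) :
    offerValue u o = ENNReal.ofReal (optionValue o.2.1 u) := by
  have := o.2.2.1
  exact lintegral_max_ofReal u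

theorem lintegral_signal_some (u : ℝ) (O : Offers F n) [IsProbabilityMeasure F] (i : Fin n) :
    ∫⁻ m, max (ENNReal.ofReal (m : ℝ)) (ENNReal.ofReal u) ∂signal O (some i) =
      offerValue u (O i) := rfl

theorem lintegral_signal_none (u : ℝ) (O : Offers F n) [IsProbabilityMeasure F] :
    ∫⁻ m, max (ENNReal.ofReal (m : ℝ)) (ENNReal.ofReal u) ∂signal O none =
      ENNReal.ofReal (max (priorMean F) u) := by
  rw [signal, lintegral_dirac' _ (measurable_max_ofReal _), ENNReal.ofReal_max]
  rfl

theorem lintegral_signal_le [IsProbabilityMeasure F] (u : ℝ) (O : Offers F n) (w : Choice n) :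
    ∫⁻ m, max (ENNReal.ofReal (m : ℝ)) (ENNReal.ofReal u) ∂signal O w ≤
      ENNReal.ofReal (optionValue F u) := by
  rw [lintegral_max_ofReal]
  exact ENNReal.ofReal_le_ofReal (isMPC_signal O w u)

theorem measurable_lintegral_signal [IsProbabilityMeasure F] (u : ℝ) (w : Choice n) :
    Measurable fun O : Offers F n =>
      ∫⁻ m, max (ENNReal.ofReal (m : ℝ)) (ENNReal.ofReal u) ∂signal O w := by
  cases w with
  | none => simp only [lintegral_signal_none]; exact measurable_const
  | some i => exact (measurable_offerValue u).comp (measurable_pi_apply i)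

theorem measurable_price (w : Choice n) :
    Measurable fun O : Offers F n => (price O w : ℝ≥0∞) := by
  cases w with
  | none => simp only [price]; exact measurable_const
  | some i => exact (measurable_fst.comp (measurable_pi_apply i)).coe_nnreal_ennreal

/-- If a signal is worth more than the outside option by at least the search cost, then it leads to
stopping with at least that probability. -/
theorem measure_lt_le {G : Measure Theta} [IsProbabilityMeasure G] {k : ℝ} {v : ℝ≥0∞} (hv : v ≠ ⊤)
    (h : v + ENNReal.ofReal k ≤ ∫⁻ m, max (ENNReal.ofReal (m : ℝ)) v ∂G) :
    G {m : Theta | ENNReal.ofReal (m : ℝ) < v} ≤ 1 - ENNReal.ofReal k := by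
  have hS : MeasurableSet {m : Theta | ENNReal.ofReal (m : ℝ) < v} :=
    measurableSet_lt (by fun_prop) measurable_const
  -- Where the posterior mean is below `v`, the maximum is `v`; elsewhere it is at most 1. So the
  -- expected maximum plus the probability of continuing is at most `v + 1`.
  have h1 : ∫⁻ m, (max (ENNReal.ofReal (m : ℝ)) v +
      indicator {m : Theta | ENNReal.ofReal (m : ℝ) < v} 1 m) ∂G ≤ ∫⁻ _, (v + 1) ∂G := by
    refine lintegral_mono fun m => ?_
    by_cases hm : ENNReal.ofReal (m : ℝ) < v
    · rw [indicator_of_mem (by exact hm), max_eq_right hm.le]; exact le_rfl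
    · rw [indicator_of_notMem (by exact hm), max_eq_left (not_lt.1 hm), add_zero]
      exact (ENNReal.ofReal_le_one.2 m.2.2).trans le_add_self
  rw [lintegral_add_left (measurable_max_ofReal _), lintegral_indicator_one hS, lintegral_const,
    measure_univ, mul_one] at h1
  refine ENNReal.le_sub_of_add_le_right ENNReal.ofReal_ne_top
    ((ENNReal.add_le_add_iff_left hv).1 ?_)
  calc _ = _ := by ring
    _ ≤ _ := add_le_add h le_rfl
    _ ≤ _ := h1

theorem one_sub_ofReal_lt_one {k : ℝ} (hk : 0 < k) : 1 - ENNReal.ofReal k < 1 :=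
  ENNReal.sub_lt_self ENNReal.one_ne_top one_ne_zero (by simpa using hk)

/-- The strategy of a broker that makes the same offer after each history. -/
def constantOffer (n : ℕ) (o : Offer F) : BrokerStrategy F n where
  offer _ := Kernel.const _ (Measure.dirac o)
  isMarkov _ := inferInstance

theorem ae_offer {β : Fin n → BrokerStrategy F n} {i : Fin n} {t : ℕ} {h : Hist F n t}
    {p : Offer F → Prop} (hp : ∀ᵐ o ∂(β i).offer t h, p o) :
    ∀ᵐ O ∂(Measure.pi fun j => (β j).offer t h), p (O i) := by
  have := fun j => (β j).isMarkov t
  exact Measure.tendsto_eval_ae_ae.eventually hp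

/-- A Dirac mass gives almost sure statements for measurable properties of offers. Hence properties
used on the path are phrased below through prices, option values and probabilities rather than as
equality with a given offer. -/
theorem ae_constantOffer {β : Fin n → BrokerStrategy F n} {i : Fin n} {o : Offer F}
    (hβ : β i = constantOffer n o) {p : Offer F → Prop} (hp : MeasurableSet {o | p o}) (ho : p o)
    (t : ℕ) (h : Hist F n t) :
    ∀ᵐ O ∂(Measure.pi fun j => (β j).offer t h), p (O i) := by
  refine ae_offer ?_
  rw [hβ]
  simp only [constantOffer, Kernel.const_apply]
  exact (ae_dirac_iff hp).2 ho

theorem mem_equilibriumPayoffs [IsProbabilityMeasure F] {k : ℝ} {σ : Profile F n}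
    (hσ : IsEquilibrium k σ) {b : Fin n → ℝ} {a : ℝ}
    (hb : ∀ i, ((b i : ℝ) : EReal) = (brokerPayoff σ i 0 Fin.elim0 : ℝ≥0∞))
    (ha : ((a : ℝ) : EReal) = agentPayoff k σ 0 Fin.elim0) :
    (Fin.snoc (α := fun _ => ℝ) b a : Fin (n + 1) → ℝ) ∈ equilibriumPayoffs F n k :=
  ⟨σ, hσ, fun i => by rw [Fin.snoc_castSucc]; exact hb i, by rw [Fin.snoc_last]; exact ha⟩

end Offers

/-! ### Free full information under competition -/

section Competition

variable {F : Measure Theta} [IsProbabilityMeasure F] {n : ℕ}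

/-- Several brokers that give full information for free are in equilibrium. -/
theorem competition_mem {k u : ℝ} (hk : k ∈ Ioo 0 (priorMean F)) (hu : IsMcCall F k u)
    (hn : 1 < n) :
    (Fin.snoc (α := fun _ => ℝ) 0 u : Fin (n + 1) → ℝ) ∈ equilibriumPayoffs F n k := by
  have huk : 0 < u := (sub_pos.2 hk.2).trans_le (autarky_le_of_isMcCall hk.1 hu)
  have hΦ := isMcCall_iff.1 hu
  set val : Offers F n → Choice n → ℝ≥0∞ := fun O w =>
    (∫⁻ m, max (ENNReal.ofReal (m : ℝ)) (ENNReal.ofReal u) ∂signal O w) - price O w with hval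
  have hvalm : ∀ w, Measurable fun O => val O w := fun w =>
    (measurable_lintegral_signal u w).sub (measurable_price w)
  obtain ⟨sel, hsel, hopt⟩ := exists_measurable_argmax val hvalm
  -- The subtraction in `val` truncates at 0. The null offer is worth at least u > 0, so it does not
  -- truncate at the optimum.
  have hpos : ∀ O, 0 < val O (sel O) := fun O => by
    refine lt_of_lt_of_le ?_ (hopt O none)
    simp only [hval, price, lintegral_signal_none, ENNReal.coe_zero, tsub_zero,
      ENNReal.ofReal_pos]
    exact lt_max_of_lt_right huk
  have hge : ∀ O, val O (sel O) + price O (sel O) =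
      ∫⁻ m, max (ENNReal.ofReal (m : ℝ)) (ENNReal.ofReal u) ∂signal O (sel O) := fun O =>
    tsub_add_cancel_of_le (tsub_pos_iff_lt.1 (hpos O)).le
  let good : Offer F → Prop := fun o => o.1 = 0 ∧ offerValue u o = ENNReal.ofReal (u + k)
  have hgood : MeasurableSet {o | good o} :=
    (measurable_fst (measurableSet_singleton (0 : ℝ≥0))).inter
      (measurable_offerValue u (measurableSet_singleton (ENNReal.ofReal (u + k))))
  have hgood0 : good (0, fullSignal F) := ⟨rfl, by rw [offerValue_eq]; exact congrArg _ hΦ⟩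
  have hbest : ∀ (O : Offers F n) i, good (O i) → ENNReal.ofReal (u + k) ≤ val O (sel O) := by
    intro O i hi
    refine le_trans ?_ (hopt O (some i))
    simp [hval, lintegral_signal_some, price, hi.1, hi.2]
  -- Once some broker offers full information for free, the net value is already the maximal u + k,
  -- so an optimal purchase cannot cost anything, however ties are broken.
  have hB : ∀ (O : Offers F n) i, good (O i) → val O (sel O) = ENNReal.ofReal (u + k) ∧
      price O (sel O) = 0 := by
    intro O i hi
    have h1 := hbest O i hi
    have h2 := hge O
    have h3 := lintegral_signal_le u O (sel O)
    rw [hΦ, ← h2] at h3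
    refine ⟨le_antisymm (le_self_add.trans h3) h1, ?_⟩
    have h4 : ENNReal.ofReal (u + k) + price O (sel O) ≤ ENNReal.ofReal (u + k) + 0 := by
      rw [add_zero]; exact (add_le_add h1 le_rfl).trans h3
    simpa using (ENNReal.add_le_add_iff_left ENNReal.ofReal_ne_top).1 h4
  let β : Fin n → BrokerStrategy F n := fun _ => constantOffer n (0, fullSignal F)
  have hae : ∀ t h, ∀ᵐ O ∂(Measure.pi fun i => (β i).offer t h), good (O ⟨0, by omega⟩) :=
    fun t h => ae_constantOffer rfl hgood hgood0 t h
  have H : IsOptimal k β sel (ENNReal.ofReal u) (fun _ _ => ENNReal.ofReal u)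
      (fun O => val O (sel O)) (1 - ENNReal.ofReal k) :=
    { measurable := (measurable_from_prod_countable_left
        (f := fun y : Offers F n × Choice n => val y.1 y.2) hvalm).comp (measurable_id.prodMk hsel)
      start_le_one := ENNReal.ofReal_le_one.2 (hu.lt_one hk.1).le
      le_one := fun _ _ => ENNReal.ofReal_le_one.2 (hu.lt_one hk.1).le
      le := fun O w => le_tsub_add.trans (add_le_add (hopt O w) le_rfl)
      ge := fun O => (hge O).le
      start := fun t h => by
        have e : promised (ENNReal.ofReal u) (fun (_ : Offers F n) _ => ENNReal.ofReal u) t h =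
            ENNReal.ofReal u := by cases t <;> rfl
        rw [lintegral_congr_ae ((hae t h).mono fun O hO => (hB O _ hO).1), e,
          ← ENNReal.ofReal_add huk.le hk.1.le]
        exact lintegral_offers_one ⟨β, stationaryAgent sel hsel (fun _ _ => 0)
          fun _ => measurable_const⟩ t h _
      cont := fun t h => (hae t h).mono fun O hO => by
        refine measure_lt_le ENNReal.ofReal_ne_top ?_
        rw [← hge O, (hB O _ hO).1, ENNReal.ofReal_add huk.le hk.1.le]
        exact le_self_add
      lt_one := one_sub_ofReal_lt_one hk.1 }
  -- A single rival `j` who sticks to her offer keeps the price of the purchase at 0; with `n > 1`,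
  -- one remains after any unilateral deviation.
  have hzero : ∀ (β' : Fin n → BrokerStrategy F n) (i j : Fin n), β' j = β j →
      ∀ t h, brokerPayoff ⟨β', stationaryAgent sel hsel (fun _ _ => ENNReal.ofReal u)
        fun _ => measurable_const⟩ i t h = 0 := by
    intro β' i j hj
    refine brokerPayoff_eq_zero i fun t h =>
      (ae_constantOffer (hj.trans rfl) hgood hgood0 t h).mono fun O hO hs => ?_
    have := (hB O j hO).2
    rwa [hs] at this
  refine mem_equilibriumPayoffs (H.isEquilibrium (hsel := hsel) (hv := fun _ => measurable_const)
    fun i τ t h => ?_) (fun i => ?_) ?_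
  · obtain ⟨j, hj⟩ : ∃ j : Fin n, j ≠ i := by
      have : Nontrivial (Fin n) := Fin.nontrivial_iff_two_le.2 hn
      exact exists_ne i
    refine (hzero (Function.update β i τ) i j (Function.update_of_ne hj _ _) t h).le.trans zero_le
  · rw [hzero β i i rfl]; simp
  · rw [H.agentPayoff_eq, EReal.coe_ennreal_ofReal, max_eq_left huk.le]

end Competition

/-! ### Full extraction by a monopolist -/

section Monopoly

variable {F : Measure Theta} [IsProbabilityMeasure F]

theorem measurableSet_lt_const (u : ℝ) : MeasurableSet {θ : Theta | (θ : ℝ) < u} :=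
  measurableSet_lt measurable_subtype_coe measurable_const

/-- The binary signal that reveals whether the quality is below `u`. -/
def cutoffSignal (F : Measure Theta) [IsProbabilityMeasure F] (u : ℝ) : Signal F :=
  revealing F (measurableSet_lt_const u)

/-- The price at which the agent is indifferent between the binary signal that is efficient and the
null offer, if the continuation value is that of autarky. -/
def monopolyPrice (F : Measure Theta) (k u : ℝ) : ℝ :=
  F.real {θ : Theta | (θ : ℝ) < u}ᶜ * (u - autarky F k)

theorem measureReal_add_compl (u : ℝ) :
    F.real {θ : Theta | (θ : ℝ) < u} + F.real {θ : Theta | (θ : ℝ) < u}ᶜ = 1 :=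
  probReal_add_probReal_compl (measurableSet_lt_const u)

theorem measureReal_compl_pos {k u : ℝ} (hk : 0 < k) (hu : IsMcCall F k u) :
    0 < F.real {θ : Theta | (θ : ℝ) < u}ᶜ := by
  have h := measure_lt_lt_one (G := F) (u := u) (by rw [isMcCall_iff.1 hu]; linarith)
  have h2 := measureReal_add_compl (F := F) u
  have h3 : F.real {θ : Theta | (θ : ℝ) < u} < 1 := by
    have := (ENNReal.toReal_lt_toReal (measure_ne_top _ _) ENNReal.one_ne_top).2 h
    rwa [ENNReal.toReal_one] at this
  linarith

/-- The McCall equation, read as the expected gain over u from qualities above u. -/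
theorem measureReal_compl_mul_condMean {k u : ℝ} (hu : IsMcCall F k u) :
    F.real {θ : Theta | (θ : ℝ) < u}ᶜ * condMean F {θ : Theta | (θ : ℝ) < u}ᶜ =
      F.real {θ : Theta | (θ : ℝ) < u}ᶜ * u + k := by
  have hc : {θ : Theta | (θ : ℝ) < u}ᶜ = {θ : Theta | u ≤ (θ : ℝ)} := by ext; simp
  rw [measureReal_mul_condMean]
  unfold IsMcCall at hu
  rw [hc]
  rw [integral_sub (integrable_of_continuous (by fun_prop)).restrict (integrable_const _)] at hu
  simp only [integral_const, measureReal_restrict_apply_univ, smul_eq_mul] at hu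
  linarith

theorem measureReal_mul_condMean_lt {k u : ℝ} (hu : IsMcCall F k u) :
    F.real {θ : Theta | (θ : ℝ) < u} * condMean F {θ : Theta | (θ : ℝ) < u} =
      autarky F k - F.real {θ : Theta | (θ : ℝ) < u}ᶜ * u := by
  have h1 := measureReal_compl_mul_condMean hu
  have h2 : priorMean F = _ := (integral_add_compl (measurableSet_lt_const u)
    (integrable_of_continuous (G := F) (f := fun θ : Theta => (θ : ℝ)) (by fun_prop))).symm
  rw [← measureReal_mul_condMean, ← measureReal_mul_condMean] at h2
  unfold autarky
  linarith

/-- By total expectation, F(θ < u) · E[θ | θ < u] = a - F(θ ≥ u) · u, which is below F(θ < u) · a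
when a < u. So bad news makes the agent continue even if continuation yields only a. -/
theorem condMean_lt_autarky {k u : ℝ} (hk : 0 < k) (hu : IsMcCall F k u)
    (h0 : F {θ : Theta | (θ : ℝ) < u} ≠ 0) :
    condMean F {θ : Theta | (θ : ℝ) < u} < autarky F k := by
  have h1 := measureReal_mul_condMean_lt hu
  have h2 := measureReal_compl_pos hk hu
  have h3 := measureReal_add_compl (F := F) u
  have h4 : 0 < F.real {θ : Theta | (θ : ℝ) < u} := ENNReal.toReal_pos h0 (measure_ne_top _ _)
  have h5 : autarky F k < u := by
    refine lt_of_le_of_ne (autarky_le_of_isMcCall hk hu) fun h => h0 ?_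
    have h6 := isMcCall_iff.1 hu
    have h7 : ∫ θ : Theta, (max (θ : ℝ) u - θ) ∂F = 0 := by
      rw [integral_sub (integrable_max u) (integrable_of_continuous (by fun_prop))]
      change optionValue F u - priorMean F = 0
      unfold autarky at h
      linarith
    rw [integral_eq_zero_iff_of_nonneg (fun m => sub_nonneg.2 (le_max_left _ _))
      ((integrable_max u).sub (integrable_of_continuous (by fun_prop)))] at h7
    refine measure_eq_zero_iff_ae_notMem.2 (h7.mono fun θ e hθ => ?_)
    simp only [Pi.zero_apply] at e
    rw [max_eq_right (le_of_lt hθ)] at e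
    have : (θ : ℝ) < u := hθ
    linarith
  refine lt_of_mul_lt_mul_left (a := F.real {θ : Theta | (θ : ℝ) < u}) ?_ h4.le
  rw [h1]
  have h6 := mul_lt_mul_of_pos_left h5 h2
  have h7 : autarky F k = F.real {θ : Theta | (θ : ℝ) < u} * autarky F k +
      F.real {θ : Theta | (θ : ℝ) < u}ᶜ * autarky F k := by rw [← add_mul, h3, one_mul]
  linarith

theorem optionValue_cutoffSignal {k u : ℝ} (hk : 0 < k) (hu : IsMcCall F k u) :
    optionValue (cutoffSignal F u).1 (autarky F k) = priorMean F + monopolyPrice F k u := by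
  have h2 := measureReal_compl_pos hk hu
  have h3 := measureReal_add_compl (F := F) u
  have h4 := measureReal_compl_mul_condMean hu
  have hle := autarky_le_of_isMcCall hk hu
  unfold optionValue cutoffSignal revealing
  rw [integral_binarySignal (fun m : Theta => max (m : ℝ) (autarky F k))]
  simp only [condMeanPt]
  -- The factor is kept because the conditional mean on a null event is only a default value.
  have e1 : F.real {θ : Theta | (θ : ℝ) < u} *
      max (condMean F {θ : Theta | (θ : ℝ) < u}) (autarky F k) =
      F.real {θ : Theta | (θ : ℝ) < u} * autarky F k := by
    by_cases h0 : F {θ : Theta | (θ : ℝ) < u} = 0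
    · simp [Measure.real, h0]
    · rw [max_eq_right (condMean_lt_autarky hk hu h0).le]
  have e2 : autarky F k ≤ condMean F {θ : Theta | (θ : ℝ) < u}ᶜ := by
    refine hle.trans (le_of_mul_le_mul_left ?_ h2)
    rw [h4]; linarith
  rw [e1, max_eq_left e2, h4]
  unfold monopolyPrice
  have h5 : F.real {θ : Theta | (θ : ℝ) < u} = 1 - F.real {θ : Theta | (θ : ℝ) < u}ᶜ := by linarith
  rw [h5]
  unfold autarky
  ring

theorem measure_le_cutoffSignal {k u : ℝ} (hk : 0 < k) (hu : IsMcCall F k u) :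
    F {θ : Theta | (θ : ℝ) < u} ≤ (cutoffSignal F u).1 {m : Theta | (m : ℝ) < autarky F k} := by
  by_cases h0 : F {θ : Theta | (θ : ℝ) < u} = 0
  · rw [h0]; exact zero_le
  have h1 : condMeanPt F {θ : Theta | (θ : ℝ) < u} ∈ {m : Theta | (m : ℝ) < autarky F k} :=
    condMean_lt_autarky hk hu h0
  simp only [cutoffSignal, revealing, binarySignal, Measure.add_apply, Measure.smul_apply]
  rw [Measure.dirac_apply_of_mem h1, smul_eq_mul, mul_one]
  exact le_self_add

/-- With r = F(θ ≥ u), a price r(u - a) in each period and continuation probability 1 - r add up to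
u - a. This is the recursion that `le_brokerPayoff` asks for. -/
theorem ofReal_sub_le_monopolyPrice_add {k u : ℝ} (hk : 0 < k) (hu : IsMcCall F k u) :
    ENNReal.ofReal (u - autarky F k) ≤ ENNReal.ofReal (monopolyPrice F k u) +
      F {θ : Theta | (θ : ℝ) < u} * ENNReal.ofReal (u - autarky F k) := by
  have hle := sub_nonneg.2 (autarky_le_of_isMcCall hk hu)
  have h3 := measureReal_add_compl (F := F) u
  rw [monopolyPrice, ← ofReal_measureReal, ← ENNReal.ofReal_mul measureReal_nonneg,
    ← ENNReal.ofReal_add (mul_nonneg measureReal_nonneg hle) (mul_nonneg measureReal_nonneg hle)]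
  refine ENNReal.ofReal_le_ofReal (le_of_eq ?_)
  rw [← add_mul, add_comm, h3, one_mul]

theorem setOf_ofReal_lt {u : ℝ} :
    {m : Theta | ENNReal.ofReal (m : ℝ) < ENNReal.ofReal u} = {m : Theta | (m : ℝ) < u} := by
  ext m
  exact ENNReal.ofReal_lt_ofReal_iff_of_nonneg m.2.1

/-- Raising the outside option from `x` to `y` gains the full difference whenever it is already used
at `x`. It bounds what a monopolist can earn now and later by the value of the signal at u. -/
theorem lintegral_max_add_le (G : Measure Theta) {x y : ℝ} (h0 : 0 ≤ x) (hxy : x ≤ y) :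
    ∫⁻ m, max (ENNReal.ofReal (m : ℝ)) (ENNReal.ofReal x) ∂G +
        ENNReal.ofReal (y - x) * G {m : Theta | (m : ℝ) < x} ≤
      ∫⁻ m, max (ENNReal.ofReal (m : ℝ)) (ENNReal.ofReal y) ∂G := by
  have hS := measurableSet_lt_const x
  rw [← lintegral_indicator_one hS, ← lintegral_const_mul _ (measurable_one.indicator hS),
    ← lintegral_add_left (measurable_max_ofReal _)]
  refine lintegral_mono fun m => ?_
  by_cases hm : (m : ℝ) < x
  · rw [indicator_of_mem (by exact hm), Pi.one_apply, mul_one,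
      max_eq_right (ENNReal.ofReal_le_ofReal hm.le), max_eq_right
        (ENNReal.ofReal_le_ofReal (hm.le.trans hxy)), ← ENNReal.ofReal_add h0 (sub_nonneg.2 hxy)]
    simp
  · rw [indicator_of_notMem (by exact hm), mul_zero, add_zero]
    exact max_le_max le_rfl (ENNReal.ofReal_le_ofReal hxy)

/-- A monopolist can extract the surplus, in excess of the autarky payoff, that full information
generates. -/
theorem monopoly_mem {k u : ℝ} (hk : k ∈ Ioo 0 (priorMean F)) (hu : IsMcCall F k u) :
    (Fin.snoc (α := fun _ => ℝ) (fun _ => u - autarky F k) (autarky F k) : Fin 2 → ℝ) ∈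
      equilibriumPayoffs F 1 k := by
  classical
  set a := autarky F k with ha
  have ha0 : 0 < a := sub_pos.2 hk.2
  have hau : a ≤ u := autarky_le_of_isMcCall hk.1 hu
  have hak : a + k = priorMean F := by rw [ha, autarky]; ring
  have hakE : ENNReal.ofReal (priorMean F) = ENNReal.ofReal a + ENNReal.ofReal k := by
    rw [← hak, ENNReal.ofReal_add ha0.le hk.1.le]
  have hnone : ∀ O : Offers F 1,
      ∫⁻ m, max (ENNReal.ofReal (m : ℝ)) (ENNReal.ofReal a) ∂signal O none =
        ENNReal.ofReal (priorMean F) := fun O => by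
    rw [lintegral_signal_none, max_eq_left (by linarith [hk.1])]
  -- Ties are broken in favor of the broker, whose price leaves the agent exactly indifferent.
  let acc : Offers F 1 → Prop := fun O =>
    ENNReal.ofReal (priorMean F) + ((O 0).1 : ℝ≥0∞) ≤ offerValue a (O 0)
  have hpm : Measurable fun O : Offers F 1 => ((O 0).1 : ℝ≥0∞) := measurable_price (some 0)
  have hJm : Measurable fun O : Offers F 1 => offerValue a (O 0) :=
    (measurable_offerValue a).comp (measurable_pi_apply 0)
  have hacc : MeasurableSet {O | acc O} := measurableSet_le (measurable_const.add hpm) hJm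
  let sel : Offers F 1 → Choice 1 := fun O => if acc O then some 0 else none
  have hsel : Measurable sel := Measurable.ite hacc measurable_const measurable_const
  let B : Offers F 1 → ℝ≥0∞ := fun O =>
    max (ENNReal.ofReal (priorMean F)) (offerValue a (O 0) - (O 0).1)
  have hge : ∀ O, B O + price O (sel O) ≤
      ∫⁻ m, max (ENNReal.ofReal (m : ℝ)) (ENNReal.ofReal a) ∂signal O (sel O) := by
    intro O
    by_cases h : acc O
    · have hs : sel O = some 0 := if_pos h
      rw [hs, lintegral_signal_some]
      have h1 : ENNReal.ofReal (priorMean F) ≤ offerValue a (O 0) - (O 0).1 :=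
        ENNReal.le_sub_of_add_le_right ENNReal.coe_ne_top h
      simp only [B, max_eq_right h1, price]
      exact (tsub_add_cancel_of_le (le_add_self.trans h)).le
    · have hs : sel O = none := if_neg h
      have h1 : offerValue a (O 0) - (O 0).1 ≤ ENNReal.ofReal (priorMean F) :=
        tsub_le_iff_right.2 (le_of_not_ge h)
      rw [hs, hnone]
      simp only [B, max_eq_left h1, price, ENNReal.coe_zero, add_zero, le_refl]
  let P : ℝ≥0 := Real.toNNReal (monopolyPrice F k u)
  have hP : (P : ℝ≥0∞) = ENNReal.ofReal (monopolyPrice F k u) := rfl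
  have hP0 : 0 ≤ monopolyPrice F k u := mul_nonneg measureReal_nonneg (sub_nonneg.2 hau)
  let good : Offer F → Prop := fun o => o.1 = P ∧
    offerValue a o = ENNReal.ofReal (priorMean F) + P ∧
      F {θ : Theta | (θ : ℝ) < u} ≤ o.2.1 {m : Theta | (m : ℝ) < a}
  have hgood : MeasurableSet {o | good o} :=
    (measurable_fst (measurableSet_singleton P)).inter
      ((measurable_offerValue a (measurableSet_singleton _)).inter
        (measurableSet_le measurable_const ((Measure.measurable_coe (measurableSet_lt_const a)).comp
          (measurable_subtype_coe.comp measurable_snd))))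
  have hgood0 : good (P, cutoffSignal F u) := by
    refine ⟨rfl, ?_, measure_le_cutoffSignal hk.1 hu⟩
    rw [offerValue_eq, hP, ← ENNReal.ofReal_add (priorMean_mem F).1 hP0,
      ← optionValue_cutoffSignal hk.1 hu]
  let β : Fin 1 → BrokerStrategy F 1 := fun _ => constantOffer 1 (P, cutoffSignal F u)
  have hae : ∀ t h, ∀ᵐ O ∂(Measure.pi fun i => (β i).offer t h), good (O 0) :=
    fun t h => ae_constantOffer rfl hgood hgood0 t h
  have hone : ∀ t h (x : ℝ≥0∞), ∫⁻ _, x ∂(Measure.pi fun i => (β i).offer t h) = x := fun t h x =>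
    lintegral_offers_one ⟨β, stationaryAgent sel hsel (fun _ _ => 0) fun _ => measurable_const⟩ t h x
  have H : IsOptimal k β sel (ENNReal.ofReal a) (fun _ _ => ENNReal.ofReal a) B
      (1 - ENNReal.ofReal k) :=
    { measurable := measurable_const.max (hJm.sub hpm)
      start_le_one := ENNReal.ofReal_le_one.2 (hau.trans (hu.lt_one hk.1).le)
      le_one := fun _ _ => ENNReal.ofReal_le_one.2 (hau.trans (hu.lt_one hk.1).le)
      le := fun O w => by
        cases w with
        | none => rw [hnone]; exact (le_max_left _ _).trans le_self_add
        | some i =>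
          obtain rfl : i = 0 := Subsingleton.elim _ _
          rw [lintegral_signal_some]
          exact le_tsub_add.trans (add_le_add (le_max_right _ _) le_rfl)
      ge := hge
      start := fun t h => by
        have e : promised (ENNReal.ofReal a) (fun (_ : Offers F 1) _ => ENNReal.ofReal a) t h =
            ENNReal.ofReal a := by cases t <;> rfl
        rw [e, ← hakE, ← hone t h (ENNReal.ofReal (priorMean F))]
        refine lintegral_congr_ae ((hae t h).mono fun O hO => ?_)
        simp only [B, hO.1, hO.2.1, ENNReal.add_sub_cancel_right ENNReal.coe_ne_top, max_self]
      cont := fun t h => Filter.Eventually.of_forall fun O => by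
        refine measure_lt_le ENNReal.ofReal_ne_top ?_
        rw [← hakE]
        exact (le_max_left _ _).trans (le_self_add.trans (hge O))
      lt_one := one_sub_ofReal_lt_one hk.1 }
  have hpay : ∀ t h, brokerPayoff ⟨β, stationaryAgent sel hsel (fun _ _ => ENNReal.ofReal a)
      fun _ => measurable_const⟩ 0 t h ≥ ENNReal.ofReal (u - a) := by
    refine le_brokerPayoff _ 0 (p := P) (q := F {θ : Theta | (θ : ℝ) < u})
      (measure_lt_lt_one (by rw [isMcCall_iff.1 hu]; linarith [hk.1])) ENNReal.ofReal_ne_top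
      (ofReal_sub_le_monopolyPrice_add hk.1 hu) fun t h => (hae t h).mono fun O hO => ?_
    have hs : sel O = some 0 := if_pos (by simp only [acc]; rw [hO.1, hO.2.1])
    refine ⟨by simp [stationaryAgent, Kernel.deterministic_apply, hs], by rw [hO.1], ?_⟩
    refine hO.2.2.trans ?_
    rw [← lintegral_indicator_one (measurableSet_lt_const a)]
    refine lintegral_mono fun m => ?_
    by_cases hm : (m : ℝ) < a
    swap
    · rw [indicator_of_notMem (by exact hm)]; exact zero_le
    rw [indicator_of_mem (by exact hm)]
    have : ¬ ENNReal.ofReal a ≤ ENNReal.ofReal (m : ℝ) :=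
      not_le.2 ((ENNReal.ofReal_lt_ofReal_iff_of_nonneg m.2.1).2 hm)
    simp [stationaryAgent, this]
  have hbound : ∀ (β' : Fin 1 → BrokerStrategy F 1) t h, brokerPayoff ⟨β', stationaryAgent sel hsel
      (fun _ _ => ENNReal.ofReal a) fun _ => measurable_const⟩ 0 t h ≤ ENNReal.ofReal (u - a) := by
    intro β'
    refine brokerPayoff_le 0 _ fun O hs => ?_
    have h1 : acc O := by
      by_contra h
      simp only [sel, if_neg h] at hs
      exact absurd hs (by simp)
    rw [setOf_ofReal_lt]
    refine (ENNReal.add_le_add_iff_left (ENNReal.ofReal_ne_top (r := priorMean F))).1 ?_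
    -- Acceptance bounds the price by the signal's value at a, less μ. Adding u - a times the
    -- probability of continuing gives at most the value at u, hence at most Φ(u) = u + k = μ + (u -
    -- a).
    calc _ = _ := (add_assoc _ _ _).symm
      _ ≤ offerValue a (O 0) + _ := add_le_add h1 le_rfl
      _ ≤ _ := lintegral_max_add_le _ ha0.le hau
      _ ≤ ENNReal.ofReal (optionValue F u) := lintegral_signal_le u O (some 0)
      _ = _ := by
        rw [isMcCall_iff.1 hu, ← ENNReal.ofReal_add (priorMean_mem F).1 (sub_nonneg.2 hau), ← hak]
        congr 1; ring
  refine mem_equilibriumPayoffs (H.isEquilibrium (hsel := hsel) (hv := fun _ => measurable_const)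
    fun i τ t h => ?_) (fun i => ?_) ?_
  · obtain rfl : i = 0 := Subsingleton.elim _ _
    exact (hbound _ t h).trans (hpay t h)
  · obtain rfl : i = 0 := Subsingleton.elim _ _
    rw [le_antisymm (hbound β _ _) (hpay _ _), EReal.coe_ennreal_ofReal,
      max_eq_left (sub_nonneg.2 hau)]
  · rw [H.agentPayoff_eq, EReal.coe_ennreal_ofReal, max_eq_left ha0.le]

end Monopoly

/-! ### Lotteries over offers, and rewards for refusal -/

section Mixing

variable {F : Measure Theta} {n : ℕ}

/-- The strategy of a broker that randomizes between two offers. -/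
def mixedOffer (l : ∀ t, Hist F n t → ℝ) (hl : ∀ t, Measurable (l t))
    (hl01 : ∀ t h, l t h ∈ Icc (0 : ℝ) 1) (o o' : Offer F) : BrokerStrategy F n where
  offer t :=
    { toFun := fun h => ENNReal.ofReal (l t h) • Measure.dirac o +
        ENNReal.ofReal (1 - l t h) • Measure.dirac o'
      measurable' := by
        refine Measure.measurable_of_measurable_coe _ fun s _ => ?_
        simp only [Measure.add_apply, Measure.smul_apply, smul_eq_mul]
        have := hl t
        fun_prop }
  isMarkov t := ⟨fun h => ⟨by
    change (ENNReal.ofReal (l t h) • Measure.dirac o +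
        ENNReal.ofReal (1 - l t h) • Measure.dirac o') univ = 1
    simp only [Measure.add_apply, Measure.smul_apply, measure_univ, smul_eq_mul, mul_one]
    rw [← ENNReal.ofReal_add (hl01 t h).1 (sub_nonneg.2 (hl01 t h).2)]
    simp⟩⟩

theorem mixedOffer_offer (l : ∀ t, Hist F n t → ℝ) (hl : ∀ t, Measurable (l t))
    (hl01 : ∀ t h, l t h ∈ Icc (0 : ℝ) 1) (o o' : Offer F) (t : ℕ) (h : Hist F n t) :
    (mixedOffer l hl hl01 o o').offer t h =
      ENNReal.ofReal (l t h) • Measure.dirac o + ENNReal.ofReal (1 - l t h) • Measure.dirac o' :=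
  rfl

theorem ae_mixedOffer {l : ∀ t, Hist F n t → ℝ} {hl : ∀ t, Measurable (l t)}
    {hl01 : ∀ t h, l t h ∈ Icc (0 : ℝ) 1} {o o' : Offer F} {p : Offer F → Prop}
    (hp : MeasurableSet {o | p o}) (ho : p o) (ho' : p o') (t : ℕ) (h : Hist F n t) :
    ∀ᵐ x ∂(mixedOffer l hl hl01 o o').offer t h, p x := by
  rw [mixedOffer_offer, ae_add_measure_iff]
  exact ⟨Measure.ae_smul_measure ((ae_dirac_iff hp).2 ho) _,
    Measure.ae_smul_measure ((ae_dirac_iff hp).2 ho') _⟩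

theorem measurable_promised {v₀ : ℝ≥0∞} {v : Offers F n → Choice n → ℝ≥0∞}
    (hv : ∀ w, Measurable fun O => v O w) (t : ℕ) : Measurable (promised v₀ v t) := by
  cases t with
  | zero => exact measurable_const
  | succ t =>
    have h1 : Measurable fun y : Offers F n × Choice n => v y.1 y.2 :=
      measurable_from_prod_countable_left hv
    have h2 : Measurable fun r : Record F n => v r.1 r.2.1 :=
      h1.comp (g := fun y : Offers F n × Choice n => v y.1 y.2)
        (f := fun r : Record F n => (r.1, r.2.1)) (by fun_prop)
    exact h2.comp (measurable_pi_apply (Fin.last t))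

end Mixing

section Threats

variable {F : Measure Theta} [IsProbabilityMeasure F] {n : ℕ}

/-- If refusing full information in the hope of the McCall payoff is better than obtaining it once
for free and the autarky payoff thereafter, then each payoff between these two is an
equilibrium payoff of the agent when the brokers earn nothing. -/
theorem threat_mem {k u x : ℝ} (hk : k ∈ Ioo 0 (priorMean F)) (hu : IsMcCall F k u)
    (hthr : optionValue F (autarky F k) ≤ u) (hn : 1 ≤ n) (hx : x ∈ Icc (autarky F k) u) :
    (Fin.snoc (α := fun _ => ℝ) 0 x : Fin (n + 1) → ℝ) ∈ equilibriumPayoffs F n k := by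
  classical
  set a := autarky F k with ha
  have ha0 : 0 < a := sub_pos.2 hk.2
  have hak : a + k = priorMean F := by rw [ha, autarky]; ring
  have hmu : priorMean F ≤ u := (priorMean_le_optionValue a).trans hthr
  have hau : a < u := by linarith [hk.1]
  have hu0 : 0 < u := ha0.trans hau
  have hu1 : u < 1 := hu.lt_one hk.1
  have hakE : ENNReal.ofReal (priorMean F) = ENNReal.ofReal a + ENNReal.ofReal k := by
    rw [← hak, ENNReal.ofReal_add ha0.le hk.1.le]
  let i₀ : Fin n := ⟨0, hn⟩
  let full : Offer F → Prop := fun o => o.1 = 0 ∧ offerValue u o = ENNReal.ofReal (u + k)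
  let bad : Offer F → Prop := fun o =>
    offerValue a o ≤ ENNReal.ofReal (priorMean F) + (o.1 : ℝ≥0∞)
  have hfull : MeasurableSet {o | full o} :=
    (measurable_fst (measurableSet_singleton (0 : ℝ≥0))).inter
      (measurable_offerValue u (measurableSet_singleton (ENNReal.ofReal (u + k))))
  have hbad : MeasurableSet {o | bad o} :=
    measurableSet_le (measurable_offerValue a)
      (measurable_const.add measurable_fst.coe_nnreal_ennreal)
  -- Three cases: `D`, the designated broker gives full information for free; `N`, no offer beats
  -- the null offer when continuation yields a; otherwise, some broker makes a tempting deviation.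
  let D : Offers F n → Prop := fun O => full (O i₀)
  let N : Offers F n → Prop := fun O => ∀ i, bad (O i)
  have hD : MeasurableSet {O | D O} := hfull.preimage (measurable_pi_apply i₀)
  have hN : MeasurableSet {O | N O} := by
    have : {O | N O} = ⋂ i, {O | bad (O i)} := by ext; simp [N]
    rw [this]
    exact MeasurableSet.iInter fun i => hbad.preimage (measurable_pi_apply i)
  -- After a tempting deviation, refusal is rewarded by u and purchase is punished by a.
  let v : Offers F n → Choice n → ℝ≥0∞ := fun O w => if D O then ENNReal.ofReal u else
    if N O then ENNReal.ofReal a else if w = none then ENNReal.ofReal u else ENNReal.ofReal a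
  have hv : ∀ w, Measurable fun O => v O w := fun w =>
    Measurable.ite hD measurable_const (Measurable.ite hN measurable_const measurable_const)
  let sel : Offers F n → Choice n := fun O => if D O then some i₀ else none
  have hsel : Measurable sel := Measurable.ite hD measurable_const measurable_const
  let B : Offers F n → ℝ≥0∞ := fun O => if D O then ENNReal.ofReal (u + k) else
    if N O then ENNReal.ofReal (priorMean F) else ENNReal.ofReal u
  have hBm : Measurable B :=
    Measurable.ite hD measurable_const (Measurable.ite hN measurable_const measurable_const)
  have hprice : ∀ O, price O (sel O) = 0 := fun O => by
    by_cases h : D O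
    · simp only [sel, if_pos h, price]; exact h.1
    · simp only [sel, if_neg h, price]
  -- the promised values lie between the autarky and the McCall payoff
  have hvR : ∀ O w, ∃ z ∈ Icc a u, v O w = ENNReal.ofReal z := fun O w => by
    simp only [v]
    split_ifs
    · exact ⟨u, ⟨hau.le, le_rfl⟩, rfl⟩
    · exact ⟨a, ⟨le_rfl, hau.le⟩, rfl⟩
    · exact ⟨u, ⟨hau.le, le_rfl⟩, rfl⟩
    · exact ⟨a, ⟨le_rfl, hau.le⟩, rfl⟩
  have hVR : ∀ t (h : Hist F n t), ∃ z ∈ Icc a u,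
      promised (ENNReal.ofReal x) v t h = ENNReal.ofReal z := fun t h => by
    cases t with
    | zero => exact ⟨x, hx, rfl⟩
    | succ t => exact hvR _ _
  -- The lottery solves l(u + k) + (1 - l)μ = z + k for the promise z; since μ = a + k, this gives l
  -- = (z - a)/(u - a).
  let l : ∀ t, Hist F n t → ℝ := fun t h =>
    ((promised (ENNReal.ofReal x) v t h).toReal - a) / (u - a)
  have hl : ∀ t, Measurable (l t) := fun t =>
    ((measurable_promised hv t).ennreal_toReal.sub_const a).div_const (u - a)
  have hl01 : ∀ t h, l t h ∈ Icc (0 : ℝ) 1 := fun t h => by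
    obtain ⟨z, hz, e⟩ := hVR t h
    simp only [l, e, ENNReal.toReal_ofReal (ha0.le.trans hz.1)]
    exact ⟨div_nonneg (sub_nonneg.2 hz.1) (sub_nonneg.2 hau.le),
      div_le_one_of_le₀ (by linarith [hz.2]) (sub_nonneg.2 hau.le)⟩
  have hfull0 : full (0, fullSignal F) :=
    ⟨rfl, by rw [offerValue_eq]; exact congrArg ENNReal.ofReal (isMcCall_iff (G := F).1 hu)⟩
  have hnull0 : ¬ full (0, nullSignal F) := fun h => by
    have := h.2
    rw [offerValue_eq, optionValue_nullSignal, max_eq_right hmu,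
      ENNReal.ofReal_eq_ofReal_iff hu0.le (by linarith [hk.1])] at this
    linarith [hk.1]
  have hbad0 : bad (0, nullSignal F) := by
    simp only [bad]
    rw [offerValue_eq, optionValue_nullSignal, max_eq_left (by linarith [hk.1])]
    simp
  let β : Fin n → BrokerStrategy F n := fun i =>
    if i = i₀ then mixedOffer l hl hl01 (0, fullSignal F) (0, nullSignal F)
    else constantOffer n (0, nullSignal F)
  have hβ₀ : β i₀ = mixedOffer l hl hl01 (0, fullSignal F) (0, nullSignal F) := if_pos rfl
  have hae : ∀ t h, ∀ᵐ O ∂(Measure.pi fun i => (β i).offer t h), D O ∨ N O := fun t h => by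
    have h1 : ∀ᵐ O ∂(Measure.pi fun i => (β i).offer t h), ∀ i, i ≠ i₀ → bad (O i) :=
      ae_all_iff.2 fun i => by
        by_cases hi : i = i₀
        · exact Filter.Eventually.of_forall fun _ h => absurd hi h
        · exact (ae_constantOffer (if_neg hi) hbad hbad0 t h).mono fun _ h _ => h
    have h2 : ∀ᵐ O ∂(Measure.pi fun i => (β i).offer t h), full (O i₀) ∨ bad (O i₀) := by
      refine ae_offer (p := fun o => full o ∨ bad o) ?_
      rw [hβ₀]
      exact ae_mixedOffer (hfull.union hbad) (Or.inl hfull0) (Or.inr hbad0) t h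
    filter_upwards [h1, h2] with O hO1 hO2
    refine hO2.imp id fun h i => ?_
    by_cases hi : i = i₀
    · rw [hi]; exact h
    · exact hO1 i hi
  have hB : ∀ O, D O ∨ N O → B O =
      if full (O i₀) then ENNReal.ofReal (u + k) else ENNReal.ofReal (priorMean F) := by
    intro O hO
    by_cases h : D O
    · simp only [B, if_pos h]; exact (if_pos h).symm
    · simp only [B, if_neg h, if_pos (hO.resolve_left h)]; exact (if_neg h).symm
  have H : IsOptimal k β sel (ENNReal.ofReal x) v B (1 - ENNReal.ofReal k) :=
    { measurable := hBm
      start_le_one := ENNReal.ofReal_le_one.2 (hx.2.trans hu1.le)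
      le_one := fun O w => by
        obtain ⟨z, hz, e⟩ := hvR O w
        rw [e]
        exact ENNReal.ofReal_le_one.2 (hz.2.trans hu1.le)
      le := fun O w => by
        by_cases h : D O
        · simp only [v, B, if_pos h]
          refine (lintegral_signal_le u O w).trans ?_
          rw [isMcCall_iff.1 hu]
          exact le_self_add
        by_cases h' : N O
        · simp only [v, B, if_neg h, if_pos h']
          cases w with
          | none =>
            rw [lintegral_signal_none, max_eq_left (by linarith [hk.1])]
            exact le_self_add
          | some i => exact h' i
        · simp only [v, B, if_neg h, if_neg h']
          cases w with
          | none =>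
            rw [if_pos rfl, lintegral_signal_none, max_eq_right hmu]
            exact le_self_add
          | some i =>
            rw [if_neg (by simp)]
            -- The threshold condition is used here: a tempting offer, followed by a, is worth at
            -- most Φ(a) ≤ u, the value of refusing.
            exact (lintegral_signal_le a O _).trans
              ((ENNReal.ofReal_le_ofReal hthr).trans le_self_add)
      ge := fun O => by
        rw [hprice, ENNReal.coe_zero, add_zero]
        by_cases h : D O
        · simp only [v, B, sel, if_pos h]
          exact h.2.ge
        · simp only [v, B, sel, if_neg h, if_true]
          split_ifs <;> rw [lintegral_signal_none]
          · exact ENNReal.ofReal_le_ofReal (le_max_left _ _)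
          · exact ENNReal.ofReal_le_ofReal (le_max_right _ _)
      start := fun t h => by
        have := fun i => (β i).isMarkov t
        rw [lintegral_congr_ae ((hae t h).mono hB)]
        have hf : Measurable fun o : Offer F => if full o then ENNReal.ofReal (u + k) else
            ENNReal.ofReal (priorMean F) := Measurable.ite hfull measurable_const measurable_const
        have := (measurePreserving_eval (fun i => (β i).offer t h) i₀).lintegral_comp hf
        simp only [Function.eval] at this
        rw [this, hβ₀, mixedOffer_offer, lintegral_add_measure, lintegral_smul_measure,
          lintegral_smul_measure, lintegral_dirac' _ hf, lintegral_dirac' _ hf, if_pos hfull0,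
          if_neg hnull0]
        obtain ⟨z, hz, e⟩ := hVR t h
        have hl' := hl01 t h
        have e2 : l t h * (u - a) = z - a := by
          simp only [l, e, ENNReal.toReal_ofReal (ha0.le.trans hz.1)]
          exact div_mul_cancel₀ _ (sub_pos.2 hau).ne'
        rw [e, smul_eq_mul, smul_eq_mul, ← ENNReal.ofReal_mul hl'.1,
          ← ENNReal.ofReal_mul (sub_nonneg.2 hl'.2), ← ENNReal.ofReal_add
            (mul_nonneg hl'.1 (by linarith [hk.1]))
            (mul_nonneg (sub_nonneg.2 hl'.2) (priorMean_mem F).1),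
          ← ENNReal.ofReal_add (ha0.le.trans hz.1) hk.1.le, ← hak]
        congr 1
        linarith
      cont := fun t h => (hae t h).mono fun O hO => by
        obtain ⟨z, -, e⟩ := hvR O (sel O)
        refine measure_lt_le (by rw [e]; exact ENNReal.ofReal_ne_top) ?_
        by_cases h : D O
        · simp only [v, sel, if_pos h]
          rw [← ENNReal.ofReal_add hu0.le hk.1.le]
          exact h.2.ge
        · simp only [v, sel, if_neg h, if_pos (hO.resolve_left h)]
          rw [← hakE, lintegral_signal_none]
          exact ENNReal.ofReal_le_ofReal (le_max_left _ _)
      lt_one := one_sub_ofReal_lt_one hk.1 }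
  -- The agent never pays a positive price, whatever is offered, so no broker's deviation earns
  -- anything.
  have hzero : ∀ (β' : Fin n → BrokerStrategy F n) i t h,
      brokerPayoff ⟨β', stationaryAgent sel hsel v hv⟩ i t h = 0 := fun β' i =>
    brokerPayoff_eq_zero i fun t h => Filter.Eventually.of_forall fun O hs => by
      have := hprice O
      rwa [hs] at this
  refine mem_equilibriumPayoffs (H.isEquilibrium (hsel := hsel) (hv := hv)
    fun i τ t h => ?_) (fun i => ?_) ?_
  · exact (hzero (Function.update β i τ) i t h).le.trans zero_le
  · rw [hzero β]; simp
  · rw [H.agentPayoff_eq, EReal.coe_ennreal_ofReal, max_eq_left (ha0.le.trans hx.1)]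

end Threats

/-! ### What sequential rationality of the agent implies -/

section Necessity

variable {F : Measure Theta} [IsProbabilityMeasure F] {n : ℕ} {k : ℝ} {σ : Profile F n}

theorem lintegral_signal_none_eq (O : Offers F n) (f : Theta → ℝ≥0∞) :
    ∫⁻ m, f m ∂signal O none = f (priorMeanPt F) := by
  rw [signal, lintegral_dirac]

/-- The agent's strategy of consuming, without information, in each period. -/
def autarkyStrategy (F : Measure Theta) (n : ℕ) : AgentStrategy F n :=
  stationaryAgent (fun _ => none) measurable_const (fun _ _ => 0) fun _ => measurable_const

theorem valueAtOffers_autarky (β : Fin n → BrokerStrategy F n) (g : Flow F n) (t : ℕ)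
    (x : Hist F n (t + 1) → ℝ≥0∞) (h : Hist F n t) (O : Offers F n) :
    valueAtOffers ⟨β, autarkyStrategy F n⟩ g t x h O = g O none (priorMeanPt F) 0 := by
  rw [autarkyStrategy, valueAtOffers_stationary, lintegral_signal_none_eq]
  simp [valueAtSignal, stationaryAgent]

theorem le_total_consumption_autarky (β : Fin n → BrokerStrategy F n) (t : ℕ) (h : Hist F n t) :
    ENNReal.ofReal (priorMean F) ≤ total ⟨β, autarkyStrategy F n⟩ consumption t h := by
  refine le_trans (le_of_eq ?_)
    (le_iSup (fun T => accrued ⟨β, autarkyStrategy F n⟩ consumption T t h) 1)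
  simp only [accrued, valueAtStart, valueAtOffers_autarky, consumption, tsub_zero, mul_one]
  exact (lintegral_offers_one ⟨β, autarkyStrategy F n⟩ t h _).symm

theorem total_spending_autarky_le (β : Fin n → BrokerStrategy F n) (t : ℕ) (h : Hist F n t) :
    total ⟨β, autarkyStrategy F n⟩ (spending k) t h ≤ ENNReal.ofReal k := by
  refine iSup_le fun T => ?_
  cases T with
  | zero => exact zero_le
  | succ T =>
    simp only [accrued, valueAtStart, valueAtOffers_autarky, spending, price, ENNReal.coe_zero,
      add_zero]
    exact (lintegral_offers_one ⟨β, autarkyStrategy F n⟩ t h _).le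

namespace IsEquilibrium

variable (hσ : IsEquilibrium k σ)

include hσ

/-- Infinite spending means a payoff of `⊥`, and consuming at once without information does better.
-/
theorem total_spending_ne_top (t : ℕ) (h : Hist F n t) : total σ (spending k) t h ≠ ⊤ := by
  intro htop
  have h1 := hσ.agent_start (autarkyStrategy F n) t h
  have h2 := total_spending_autarky_le (k := k) σ.broker t h
  rw [agentPayoff, agentPayoff, htop, EReal.coe_ennreal_top, EReal.sub_top, le_bot_iff] at h1
  have h3 : total (σ.deviateAgent (autarkyStrategy F n)) (spending k) t h ≠ ⊤ :=
    ne_top_of_le_ne_top ENNReal.ofReal_ne_top h2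
  have h4 : total (σ.deviateAgent (autarkyStrategy F n)) consumption t h ≠ ⊤ :=
    ne_top_of_le_ne_top ENNReal.one_ne_top (total_consumption_le _ t h)
  lift total (σ.deviateAgent (autarkyStrategy F n)) (spending k) t h to ℝ≥0 using h3 with S
  lift total (σ.deviateAgent (autarkyStrategy F n)) consumption t h to ℝ≥0 using h4 with C
  rw [EReal.coe_nnreal_eq_coe_real, EReal.coe_nnreal_eq_coe_real, ← EReal.coe_sub] at h1
  exact EReal.coe_ne_bot _ h1

theorem autarky_add_spending_le (hk : k ∈ Ioo 0 (priorMean F)) (t : ℕ) (h : Hist F n t) :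
    ENNReal.ofReal (autarky F k) + total σ (spending k) t h ≤ total σ consumption t h := by
  have hC : ∀ σ : Profile F n, total σ consumption t h ≠ ⊤ := fun σ =>
    ne_top_of_le_ne_top ENNReal.one_ne_top (total_consumption_le σ t h)
  have h1 := (coe_sub_le_coe_sub_iff (hC _) (hC _) (hσ.total_spending_ne_top t h)).1
    (hσ.agent_start (autarkyStrategy F n) t h)
  refine (ENNReal.add_le_add_iff_right (ENNReal.ofReal_ne_top (r := k))).1 ?_
  calc _ = ENNReal.ofReal (priorMean F) + total σ (spending k) t h := by
        have ha : 0 ≤ autarky F k := sub_nonneg.2 hk.2.le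
        rw [add_right_comm, ← ENNReal.ofReal_add ha hk.1.le, autarky, sub_add_cancel]
    _ ≤ _ := add_le_add (le_total_consumption_autarky σ.broker t h) le_rfl
    _ ≤ _ := h1
    _ ≤ _ := add_le_add le_rfl (total_spending_autarky_le σ.broker t h)

end IsEquilibrium

/-- The agent's payoff from a history, if it is nonnegative. -/
def agentValue (k : ℝ) (σ : Profile F n) (t : ℕ) (h : Hist F n t) : ℝ≥0∞ :=
  total σ consumption t h - total σ (spending k) t h

/-- The agent's strategy is modified in period `t` only. -/
def modifyCont (α : AgentStrategy F n) (t : ℕ) (d : ℝ≥0∞) (hd : d ≤ 1) : AgentStrategy F n :=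
  { α with
    cont := Function.update α.cont t fun _ => d
    measurable_cont := fun s => by
      by_cases hs : s = t
      · subst hs; rw [Function.update_self]; exact measurable_const
      · rw [Function.update_of_ne hs]; exact α.measurable_cont s
    cont_le_one := fun s x => by
      by_cases hs : s = t
      · subst hs; rw [Function.update_self]; exact hd
      · rw [Function.update_of_ne hs]; exact α.cont_le_one s x }

/-- The agent's strategy is modified in period `t` only, so as to choose `w`. -/
def modifyBuy (α : AgentStrategy F n) (t : ℕ) (w : Choice n) : AgentStrategy F n :=
  { α with
    buy := Function.update α.buy t (Kernel.const _ (Measure.dirac w))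
    isMarkov := fun s => by
      by_cases hs : s = t
      · subst hs; rw [Function.update_self]; infer_instance
      · rw [Function.update_of_ne hs]; exact α.isMarkov s }

theorem total_modifyCont (g : Flow F n) (t : ℕ) (d : ℝ≥0∞) (hd : d ≤ 1) :
    total (σ.deviateAgent (modifyCont σ.agent t d hd)) g (t + 1) = total σ g (t + 1) :=
  funext fun h => total_congr (σ := σ.deviateAgent (modifyCont σ.agent t d hd)) (σ' := σ)
    g (t + 1) (fun _ _ _ => rfl) (fun _ _ => rfl)
    (fun _ hs => Function.update_of_ne (by omega) _ _) h

theorem total_modifyBuy (g : Flow F n) (t : ℕ) (w : Choice n) :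
    total (σ.deviateAgent (modifyBuy σ.agent t w)) g (t + 1) = total σ g (t + 1) :=
  funext fun h => total_congr (σ := σ.deviateAgent (modifyBuy σ.agent t w)) (σ' := σ)
    g (t + 1) (fun _ _ _ => rfl)
    (fun _ hs => Function.update_of_ne (by omega) _ _) (fun _ _ => rfl) h

theorem valueAtSignal_modifyCont (g : Flow F n) (t : ℕ) (d : ℝ≥0∞) (hd : d ≤ 1)
    (x : Hist F n (t + 1) → ℝ≥0∞) (h : Hist F n t) (O : Offers F n) (w : Choice n) (m : Theta) :
    valueAtSignal (σ.deviateAgent (modifyCont σ.agent t d hd)) g t x h O w m =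
      g O w m d + d * x (append h O w m) := by
  simp [valueAtSignal, Profile.deviateAgent, modifyCont, append]

theorem valueAtOffers_modifyBuy (g : Flow F n) (t : ℕ) (w : Choice n)
    (x : Hist F n (t + 1) → ℝ≥0∞) (h : Hist F n t) (O : Offers F n) :
    valueAtOffers (σ.deviateAgent (modifyBuy σ.agent t w)) g t x h O =
      ∫⁻ m, valueAtSignal σ g t x h O w m ∂signal O w := by
  classical
  unfold valueAtOffers
  rw [Finset.sum_eq_single w]
  · simp [Profile.deviateAgent, modifyBuy, valueAtSignal]
  · intro w' _ hw
    simp only [Profile.deviateAgent, modifyBuy, Function.update_self, Kernel.const_apply]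
    rw [Measure.dirac_apply' _ (measurableSet_singleton w'),
      indicator_of_notMem (by simpa using hw.symm), zero_mul]
  · simp

/-- The decomposition of consumption into value plus spending passes from the next history to the
current node. Here `x` is the value, `y` the spending and `z` the consumption. -/
theorem valueAtSignal_consumption_eq (t : ℕ) (h : Hist F n t)
    (O : Offers F n) (w : Choice n) (m : Theta) (x y z : Hist F n (t + 1) → ℝ≥0∞)
    (hx : x (append h O w m) + y (append h O w m) = z (append h O w m)) :
    valueAtSignal σ consumption t z h O w m + (ENNReal.ofReal k + price O w) =
      valueAtSignal σ consumption t x h O w m + valueAtSignal σ (spending k) t y h O w m := by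
  simp only [valueAtSignal, consumption, spending]
  have : z (Fin.snoc (α := fun _ => Record F n) h (O, w, m)) =
    x (Fin.snoc (α := fun _ => Record F n) h (O, w, m)) +
    y (Fin.snoc (α := fun _ => Record F n) h (O, w, m)) := hx.symm
  rw [this]
  ring

theorem IsEquilibrium.agent_stop_modifyCont (hσ : IsEquilibrium k σ) (t : ℕ) (h : Hist F n t)
    (O : Offers F n) (w : Choice n) (m : Theta)
    (d : ℝ≥0∞) (hd : d ≤ 1) :
    (ENNReal.ofReal m * (1 - d) + d * total σ consumption (t + 1) (append h O w m)) +
        valueAtSignal σ (spending k) t (total σ (spending k) (t + 1)) h O w m ≤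
      valueAtSignal σ consumption t (total σ consumption (t + 1)) h O w m +
        (ENNReal.ofReal k + price O w +
          d * total σ (spending k) (t + 1) (append h O w m)) := by
  have hC : ∀ σ : Profile F n,
      valueAtSignal σ consumption t (total σ consumption (t + 1)) h O w m ≠ ⊤ := fun σ =>
    ne_top_of_le_ne_top ENNReal.one_ne_top
      (valueAtSignal_consumption_le σ (total_consumption_le σ _) h O w m)
  have hS : valueAtSignal σ (spending k) t (total σ (spending k) (t + 1)) h O w m ≠ ⊤ :=
    ENNReal.add_ne_top.2 ⟨ENNReal.add_ne_top.2 ⟨ENNReal.ofReal_ne_top, ENNReal.coe_ne_top⟩,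
      ENNReal.mul_ne_top (ne_top_of_le_ne_top ENNReal.one_ne_top (σ.agent.cont_le_one _ _))
        (hσ.total_spending_ne_top _ _)⟩
  have h1 := (coe_sub_le_coe_sub_iff (hC _) (hC _) hS).1
    (hσ.agent_stop (modifyCont σ.agent t d hd) t h O w m)
  rw [total_modifyCont, total_modifyCont, valueAtSignal_modifyCont,
    valueAtSignal_modifyCont] at h1
  exact h1

namespace IsEquilibrium

variable (hσ : IsEquilibrium k σ) (hk : k ∈ Ioo 0 (priorMean F))

include hσ hk

theorem agentValue_add (t : ℕ) (h : Hist F n t) :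
    agentValue k σ t h + total σ (spending k) t h = total σ consumption t h :=
  tsub_add_cancel_of_le (le_add_self.trans (hσ.autarky_add_spending_le hk t h))

theorem autarky_le_agentValue (t : ℕ) (h : Hist F n t) :
    ENNReal.ofReal (autarky F k) ≤ agentValue k σ t h :=
  ENNReal.le_sub_of_add_le_right (hσ.total_spending_ne_top t h) (hσ.autarky_add_spending_le hk t h)

theorem total_spending_le_one (t : ℕ) (h : Hist F n t) : total σ (spending k) t h ≤ 1 :=
  le_add_self.trans ((hσ.autarky_add_spending_le hk t h).trans (total_consumption_le σ t h))

theorem agentValue_add_revenue_le {u : ℝ} (hu : IsMcCall F k u) (t : ℕ) (h : Hist F n t) :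
    agentValue k σ t h + ∑ i, brokerPayoff σ i t h ≤ ENNReal.ofReal u := by
  have hu0 : 0 ≤ u := (sub_nonneg.2 hk.2.le).trans (autarky_le_of_isMcCall hk.1 hu)
  have h1 := total_consumption_add_revenue_le σ hk.1 hu0 hu t h
  rw [← hσ.agentValue_add hk t h, add_right_comm] at h1
  exact (ENNReal.add_le_add_iff_right (hσ.total_spending_ne_top t h)).1 h1

theorem agentPayoff_eq (t : ℕ) (h : Hist F n t) :
    agentPayoff k σ t h = (agentValue k σ t h : ℝ≥0∞) := by
  have hS := hσ.total_spending_ne_top t h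
  have hU : agentValue k σ t h ≠ ⊤ := ne_top_of_le_ne_top ENNReal.one_ne_top
    (tsub_le_self.trans (total_consumption_le σ t h))
  rw [agentPayoff, ← hσ.agentValue_add hk t h]
  lift agentValue k σ t h to ℝ≥0 using hU with U
  lift total σ (spending k) t h to ℝ≥0 using hS with S
  rw [← ENNReal.coe_add]
  simp only [EReal.coe_nnreal_eq_coe_real, ← EReal.coe_sub]
  rw [NNReal.coe_add, add_sub_cancel_right]

/-- At a stopping node, the agent obtains the better of consumption and continuation. -/
theorem max_le_valueAtSignal (t : ℕ) (h : Hist F n t) (O : Offers F n) (w : Choice n) (m : Theta) :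
    max (ENNReal.ofReal m) (agentValue k σ (t + 1) (append h O w m)) ≤
      valueAtSignal σ consumption t (agentValue k σ (t + 1)) h O w m := by
  have hk' : ENNReal.ofReal k + (price O w : ℝ≥0∞) ≠ ⊤ :=
    ENNReal.add_ne_top.2 ⟨ENNReal.ofReal_ne_top, ENNReal.coe_ne_top⟩
  have hS' := hσ.total_spending_ne_top (t + 1) (append h O w m)
  have hS : valueAtSignal σ (spending k) t (total σ (spending k) (t + 1)) h O w m ≠ ⊤ :=
    ENNReal.add_ne_top.2 ⟨hk',
      ENNReal.mul_ne_top (ne_top_of_le_ne_top ENNReal.one_ne_top (σ.agent.cont_le_one _ _)) hS'⟩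
  have e := valueAtSignal_consumption_eq (σ := σ) (k := k) t h O w m (agentValue k σ (t + 1))
    (total σ (spending k) (t + 1)) (total σ consumption (t + 1)) (hσ.agentValue_add hk (t + 1) _)
  refine max_le ?_ ?_
  · have h1 := hσ.agent_stop_modifyCont t h O w m 0 zero_le
    rw [tsub_zero, mul_one, zero_mul, zero_mul, add_zero, add_zero, e] at h1
    exact (ENNReal.add_le_add_iff_right hS).1 h1
  · have h1 := hσ.agent_stop_modifyCont t h O w m 1 le_rfl
    rw [tsub_self, mul_zero, zero_add, one_mul, one_mul, ← add_assoc, e,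
      ← hσ.agentValue_add hk (t + 1) (append h O w m)] at h1
    refine (ENNReal.add_le_add_iff_right (ENNReal.add_ne_top.2 ⟨hS', hS⟩)).1 ?_
    calc _ = _ := by ring
      _ ≤ _ := h1
      _ = _ := by ring

/-- The agent continues if the posterior mean is below the autarky payoff. -/
theorem cont_eq_one (t : ℕ) (h : Hist F n t) (O : Offers F n) (w : Choice n) (m : Theta)
    (hm : (m : ℝ) < autarky F k) : σ.agent.cont t (h, O, w, m) = 1 := by
  have h1 := (le_max_right _ _).trans (hσ.max_le_valueAtSignal hk t h O w m)
  have h2 : ENNReal.ofReal m < agentValue k σ (t + 1) (append h O w m) :=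
    ((ENNReal.ofReal_lt_ofReal_iff_of_nonneg m.2.1).2 hm).trans_le (hσ.autarky_le_agentValue hk _ _)
  have hd := σ.agent.cont_le_one t (h, O, w, m)
  have hU : agentValue k σ (t + 1) (append h O w m) ≠ ⊤ := ne_top_of_le_ne_top ENNReal.one_ne_top
    (tsub_le_self.trans (total_consumption_le σ _ _))
  change _ ≤ ENNReal.ofReal m * (1 - σ.agent.cont t (h, O, w, m)) +
    σ.agent.cont t (h, O, w, m) * agentValue k σ (t + 1) (append h O w m) at h1
  have hdt : σ.agent.cont t (h, O, w, m) ≠ ⊤ := ne_top_of_le_ne_top ENNReal.one_ne_top hd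
  refine le_antisymm hd ?_
  lift σ.agent.cont t (h, O, w, m) to ℝ≥0 using hdt with d
  lift agentValue k σ (t + 1) (append h O w m) to ℝ≥0 using hU with U
  have hd' : d ≤ 1 := by exact_mod_cast hd
  rw [ENNReal.ofReal] at h1 h2
  norm_cast at h1 h2 ⊢
  -- An average of m and U with m < U can reach U only if all weight is on U.
  have h3 : (U : ℝ) ≤ Real.toNNReal m * (1 - d) + d * U := by
    have := NNReal.coe_le_coe.2 h1
    rwa [NNReal.coe_add, NNReal.coe_mul, NNReal.coe_mul, NNReal.coe_sub hd', NNReal.coe_one] at this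
  have h4 : ((Real.toNNReal m : ℝ≥0) : ℝ) < U := NNReal.coe_lt_coe.2 h2
  rw [← NNReal.coe_le_coe, NNReal.coe_one]
  by_contra! hlt
  nlinarith

end IsEquilibrium

end Necessity

/-! ### What a monopolist can secure in every equilibrium -/

section MonopolyNecessity

variable {F : Measure Theta} [IsProbabilityMeasure F] {k : ℝ} {σ : Profile F 1}

namespace IsEquilibrium

variable (hσ : IsEquilibrium k σ) (hk : k ∈ Ioo 0 (priorMean F))

include hσ hk

/-- The agent buys for sure if the offer is better, even when continuation yields the autarky payoff,
than the null offer, even when continuation yields an upper bound on the payoffs. -/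
theorem buy_eq_one {W : ℝ≥0∞} (hW : ∀ t h, agentValue k σ t h ≤ W) (t : ℕ) (h : Hist F 1 t)
    (O : Offers F 1)
    (hO : max (ENNReal.ofReal (priorMean F)) W + (O 0).1 < offerValue (autarky F k) (O 0)) :
    σ.agent.buy t (h, O) {some 0} = 1 := by
  set b := σ.agent.buy t (h, O) {some 0} with hb
  set b₀ := σ.agent.buy t (h, O) {none} with hb₀
  have hsum : b₀ + b = 1 := by
    have := sum_buy σ t (h, O)
    rw [Fintype.sum_option, Fin.sum_univ_one] at this
    exact this
  have hkt : ENNReal.ofReal k ≠ ⊤ := ENNReal.ofReal_ne_top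
  have hpt : ((O 0).1 : ℝ≥0∞) ≠ ⊤ := ENNReal.coe_ne_top
  set cons := valueAtSignal σ consumption t (total σ consumption (t + 1)) h O with hcons
  set spend := valueAtSignal σ (spending k) t (total σ (spending k) (t + 1)) h O with hspend
  have e := fun w m => valueAtSignal_consumption_eq (σ := σ) (k := k) t h O w m
    (agentValue k σ (t + 1)) (total σ (spending k) (t + 1)) (total σ consumption (t + 1))
    (hσ.agentValue_add hk (t + 1) _)
  set CA := ∫⁻ m, cons (some 0) m ∂signal O (some 0) with hCA
  set SA := ∫⁻ m, spend (some 0) m ∂signal O (some 0) with hSA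
  set C₀ := cons none (priorMeanPt F) with hC₀
  set S₀ := spend none (priorMeanPt F) with hS₀
  have hoffers : ∀ (g : Flow F 1) x, valueAtOffers σ g t x h O =
      b₀ * valueAtSignal σ g t x h O none (priorMeanPt F) +
        b * ∫⁻ m, valueAtSignal σ g t x h O (some 0) m ∂signal O (some 0) := by
    intro g x
    unfold valueAtOffers
    rw [Fintype.sum_option, Fin.sum_univ_one, lintegral_signal_none_eq]
  -- finiteness
  have hcons1 : ∀ w m, cons w m ≤ 1 := fun w m =>
    valueAtSignal_consumption_le σ (total_consumption_le σ _) h O w m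
  have hspend1 : ∀ w m, spend w m ≤ ENNReal.ofReal k + price O w + 1 := fun w m =>
    add_le_add le_rfl (mul_le_one' (σ.agent.cont_le_one _ _) (hσ.total_spending_le_one hk _ _))
  have hCAt : CA ≠ ⊤ := ne_top_of_le_ne_top ENNReal.one_ne_top
    (lintegral_signal_le_one fun m => hcons1 _ m)
  have hSAt : SA ≠ ⊤ := by
    refine ne_top_of_le_ne_top ?_ (lintegral_mono fun m => hspend1 (some 0) m)
    simp [price]
  have hC₀t : C₀ ≠ ⊤ := ne_top_of_le_ne_top ENNReal.one_ne_top (hcons1 _ _)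
  have hS₀t : S₀ ≠ ⊤ := by
    refine ne_top_of_le_ne_top ?_ (hspend1 none (priorMeanPt F))
    simp [price]
  have hbt : b ≠ ⊤ := ne_top_of_le_ne_top ENNReal.one_ne_top (hsum ▸ le_add_self)
  have hb₀t : b₀ ≠ ⊤ := ne_top_of_le_ne_top ENNReal.one_ne_top (hsum ▸ le_self_add)
  -- buying surely is not a profitable deviation
  have hdev : CA + (b₀ * S₀ + b * SA) ≤ (b₀ * C₀ + b * CA) + SA := by
    have h1 := hσ.agent_buy (modifyBuy σ.agent t (some 0)) t h O
    simp only [agentPayoffAtOffers, total_modifyBuy, valueAtOffers_modifyBuy, hoffers] at h1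
    refine (coe_sub_le_coe_sub_iff hCAt ?_ ?_).1 h1
    · exact ENNReal.add_ne_top.2 ⟨ENNReal.mul_ne_top hb₀t hC₀t, ENNReal.mul_ne_top hbt hCAt⟩
    · exact ENNReal.add_ne_top.2 ⟨ENNReal.mul_ne_top hb₀t hS₀t, ENNReal.mul_ne_top hbt hSAt⟩
  -- the value of buying
  have hA : offerValue (autarky F k) (O 0) + SA ≤ CA + (ENNReal.ofReal k + (O 0).1) := by
    have h1 := lintegral_mono (μ := signal O (some 0))
      (f := fun m => max (ENNReal.ofReal (m : ℝ)) (ENNReal.ofReal (autarky F k)) + spend (some 0) m)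
      (g := fun m => cons (some 0) m + (ENNReal.ofReal k + price O (some 0))) fun m => by
        simp only [hcons, hspend]
        rw [e (some 0) m]
        exact add_le_add ((max_le_max le_rfl (hσ.autarky_le_agentValue hk _ _)).trans
          (hσ.max_le_valueAtSignal hk t h O (some 0) m)) le_rfl
    rw [lintegral_add_left (measurable_max_ofReal _), lintegral_add_right _ measurable_const,
      lintegral_const, measure_univ, mul_one, lintegral_signal_some] at h1
    exact h1
  -- the value of the null offer
  have hN : C₀ + ENNReal.ofReal k ≤ max (ENNReal.ofReal (priorMean F)) W + S₀ := by
    have h1 := valueAtSignal_le σ k (fun O w => price O w)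
      (vC := total σ consumption (t + 1)) (vS := total σ (spending k) (t + 1)) (x := W) (h := h)
      (O := O) (w := none) (m := priorMeanPt F)
      (by rw [← hσ.agentValue_add hk]; exact add_le_add (hW _ _) le_rfl)
    simp only [price, ENNReal.coe_zero, add_zero] at h1
    exact h1
  have hlt : C₀ + SA < CA + S₀ := by
    have h1 : C₀ + ENNReal.ofReal k + (O 0).1 + SA < CA + (ENNReal.ofReal k + (O 0).1) + S₀ := by
      calc _ ≤ max (ENNReal.ofReal (priorMean F)) W + S₀ + (O 0).1 + SA := by gcongr
        _ = (max (ENNReal.ofReal (priorMean F)) W + (O 0).1) + (SA + S₀) := by ring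
        _ < offerValue (autarky F k) (O 0) + (SA + S₀) :=
          (ENNReal.add_lt_add_iff_right (ENNReal.add_ne_top.2 ⟨hSAt, hS₀t⟩)).2 hO
        _ = (offerValue (autarky F k) (O 0) + SA) + S₀ := (add_assoc _ _ _).symm
        _ ≤ _ := by gcongr
    refine (ENNReal.add_lt_add_iff_right (ENNReal.add_ne_top.2 ⟨hkt, hpt⟩)).1 ?_
    calc _ = _ := by ring
      _ < _ := h1
      _ = _ := by ring
  clear_value b b₀ CA SA C₀ S₀
  lift b to ℝ≥0 using hbt
  lift b₀ to ℝ≥0 using hb₀t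
  lift CA to ℝ≥0 using hCAt
  lift SA to ℝ≥0 using hSAt
  lift C₀ to ℝ≥0 using hC₀t
  lift S₀ to ℝ≥0 using hS₀t
  norm_cast at hsum hdev hlt ⊢
  rw [← NNReal.coe_le_coe] at hdev
  rw [← NNReal.coe_lt_coe] at hlt
  have hs : (b₀ : ℝ) + b = 1 := by exact_mod_cast hsum
  push_cast at hdev hlt
  -- With b = 1 - b₀, `hdev` reads b₀(CA - SA) ≤ b₀(C₀ - S₀), while `hlt` makes buying strictly
  -- better.
  have hb₀0 : (b₀ : ℝ) = 0 := by
    have h0 : (0 : ℝ) ≤ b₀ := b₀.2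
    by_contra hne
    have hpos : (0 : ℝ) < b₀ := lt_of_le_of_ne h0 (Ne.symm hne)
    have hbe : (b : ℝ) = 1 - b₀ := by linarith
    rw [hbe] at hdev
    nlinarith
  rw [← NNReal.coe_inj, NNReal.coe_one]
  linarith

/-- What a monopolist can secure by repeating the same offer. -/
theorem le_brokerPayoff_of_offer {W : ℝ≥0∞} (hW : ∀ t h, agentValue k σ t h ≤ W) (o : Offer F)
    (ho : max (ENNReal.ofReal (priorMean F)) W + o.1 < offerValue (autarky F k) o) {q c : ℝ≥0∞}
    (hq : q < 1) (hqo : q ≤ o.2.1 {m : Theta | (m : ℝ) < autarky F k}) (hc : c ≠ ⊤)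
    (hcq : c ≤ o.1 + q * c) (t : ℕ) (h : Hist F 1 t) : c ≤ brokerPayoff σ 0 t h := by
  refine le_trans ?_ (hσ.broker 0 (constantOffer 1 o) t h)
  let good : Offer F → Prop := fun x => x.1 = o.1 ∧
    max (ENNReal.ofReal (priorMean F)) W + o.1 < offerValue (autarky F k) x ∧
      q ≤ x.2.1 {m : Theta | (m : ℝ) < autarky F k}
  have hgood : MeasurableSet {x | good x} :=
    (measurable_fst (measurableSet_singleton o.1)).inter
      ((measurableSet_lt measurable_const (measurable_offerValue _)).inter
        (measurableSet_le measurable_const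
          ((Measure.measurable_coe (measurableSet_lt_const _)).comp
            (measurable_subtype_coe.comp measurable_snd))))
  refine le_brokerPayoff _ 0 (p := o.1) hq hc hcq (fun t h => ?_) t h
  have hae := ae_constantOffer (β := (σ.deviateBroker 0 (constantOffer 1 o)).broker) (i := 0)
    (o := o) (by simp [Profile.deviateBroker]) hgood ⟨rfl, ho, hqo⟩ t h
  filter_upwards [hae] with O hO
  -- The agent is sequentially rational after all histories and offers, so his response is pinned
  -- down even after repeated deviations by the broker.
  refine ⟨hσ.buy_eq_one hk hW t h O (by rw [hO.1]; exact hO.2.1), by rw [hO.1], ?_⟩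
  refine hO.2.2.trans ?_
  rw [← lintegral_indicator_one (measurableSet_lt_const _)]
  refine lintegral_mono fun m => ?_
  by_cases hm : (m : ℝ) < autarky F k
  · rw [indicator_of_mem (by exact hm)]
    exact (hσ.cont_eq_one hk t h O (some 0) m hm).ge
  · rw [indicator_of_notMem (by exact hm)]; exact zero_le

/-- Above the threshold, no promise to the agent exceeds the prior mean. -/
theorem agentValue_le_priorMean {u : ℝ} (hu : IsMcCall F k u)
    (hthr : u < optionValue F (autarky F k)) (t : ℕ) (h : Hist F 1 t) :
    agentValue k σ t h ≤ ENNReal.ofReal (priorMean F) := by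
  have ha0 : 0 < autarky F k := sub_pos.2 hk.2
  have hu0 : 0 < u := ha0.trans_le (autarky_le_of_isMcCall hk.1 hu)
  set W : ℝ≥0∞ := ⨆ (t : ℕ) (h : Hist F 1 t), agentValue k σ t h with hWdef
  have hW : ∀ t h, agentValue k σ t h ≤ W := fun t h =>
    le_iSup₂ (f := fun (t : ℕ) (h : Hist F 1 t) => agentValue k σ t h) t h
  have hWu : W ≤ ENNReal.ofReal u :=
    iSup₂_le fun t h => le_self_add.trans (hσ.agentValue_add_revenue_le hk hu t h)
  refine (hW t h).trans ?_
  by_contra! hlt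
  obtain ⟨x, hux, hx⟩ := exists_between hthr
  have hWx : W ≤ ENNReal.ofReal x := hWu.trans (ENNReal.ofReal_le_ofReal hux.le)
  have hpt : ENNReal.ofReal x - W ≠ ⊤ := ENNReal.sub_ne_top ENNReal.ofReal_ne_top
  have hcoe : ((ENNReal.ofReal x - W).toNNReal : ℝ≥0∞) = ENNReal.ofReal x - W :=
    ENNReal.coe_toNNReal hpt
  -- Refusal is worth at most `W`, and `W` plus the price `x - W` is below Φ(a), so the sale is
  -- certain. The first sale suffices, hence `q = 0`.
  have h1 := hσ.le_brokerPayoff_of_offer hk hW ((ENNReal.ofReal x - W).toNNReal, fullSignal F)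
    (by
      rw [max_eq_right hlt.le, offerValue_eq]
      simp only [hcoe, add_tsub_cancel_of_le hWx]
      exact (ENNReal.ofReal_lt_ofReal_iff_of_nonneg (hu0.le.trans hux.le)).2 hx)
    (q := 0) (c := ENNReal.ofReal x - W) (by simp) zero_le hpt (by simp only [hcoe]; simp)
  have h2 : W + (ENNReal.ofReal x - W) ≤ ENNReal.ofReal u := by
    have h3 : ∀ t h, agentValue k σ t h + (ENNReal.ofReal x - W) ≤ ENNReal.ofReal u := fun t h => by
      have := hσ.agentValue_add_revenue_le hk hu t h
      rw [Fin.sum_univ_one] at this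
      exact (add_le_add le_rfl (h1 t h)).trans this
    exact add_le_of_le_tsub_right_of_le (le_add_self.trans (h3 t h))
      (iSup₂_le fun t h => ENNReal.le_sub_of_add_le_right hpt (h3 t h))
  rw [add_tsub_cancel_of_le hWx] at h2
  exact absurd ((ENNReal.ofReal_le_ofReal_iff hu0.le).1 h2) (not_le.2 hux)

/-- Above the threshold, a monopolist extracts the whole surplus in excess of the autarky payoff. -/
theorem le_brokerPayoff_of_threshold_lt {u : ℝ} (hu : IsMcCall F k u)
    (hthr : u < optionValue F (autarky F k)) (t : ℕ) (h : Hist F 1 t) :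
    ENNReal.ofReal (u - autarky F k) ≤ brokerPayoff σ 0 t h := by
  refine le_of_forall_lt fun c hc => ?_
  obtain ⟨c', hcc', hc'⟩ := exists_between hc
  refine hcc'.trans_le ?_
  have hct : c' ≠ ⊤ := hc'.ne_top
  set s : ℝ := c'.toReal with hs
  have hsu : s < u - autarky F k := (ENNReal.lt_ofReal_iff_toReal_lt hct).1 hc'
  have hs0 : 0 ≤ s := ENNReal.toReal_nonneg
  have hcs : c' = ENNReal.ofReal s := (ENNReal.ofReal_toReal hct).symm
  -- The price r s with s < u - a undercuts the indifference price strictly, so purchase is forced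
  -- rather than left to tie-breaking; over time it earns s.
  set r := F.real {θ : Theta | (θ : ℝ) < u}ᶜ with hr
  have hr0 : 0 < r := measureReal_compl_pos hk.1 hu
  have hP : ((Real.toNNReal (r * s) : ℝ≥0) : ℝ≥0∞) = ENNReal.ofReal (r * s) := rfl
  refine hσ.le_brokerPayoff_of_offer hk (hσ.agentValue_le_priorMean hk hu hthr)
    (Real.toNNReal (r * s), cutoffSignal F u) ?_ (q := F {θ : Theta | (θ : ℝ) < u})
    (measure_lt_lt_one (by rw [isMcCall_iff.1 hu]; linarith [hk.1]))
    (measure_le_cutoffSignal hk.1 hu) hct ?_ t h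
  · rw [max_self, offerValue_eq]
    simp only [hP]
    rw [← ENNReal.ofReal_add (priorMean_mem F).1 (mul_nonneg hr0.le hs0),
      optionValue_cutoffSignal hk.1 hu]
    refine (ENNReal.ofReal_lt_ofReal_iff_of_nonneg
      (add_nonneg (priorMean_mem F).1 (mul_nonneg hr0.le hs0))).2 ?_
    unfold monopolyPrice
    have := mul_lt_mul_of_pos_left hsu hr0
    linarith
  · simp only [hP, hcs]
    rw [← ofReal_measureReal, ← ENNReal.ofReal_mul measureReal_nonneg,
      ← ENNReal.ofReal_add (mul_nonneg hr0.le hs0) (mul_nonneg measureReal_nonneg hs0), ← add_mul,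
      add_comm r, measureReal_add_compl, one_mul]

end IsEquilibrium

end MonopolyNecessity

/-! ### The sets of equilibrium payoffs -/

section Payoffs

variable {F : Measure Theta} [IsProbabilityMeasure F] {n : ℕ} {k u : ℝ}

theorem eq_toReal_of_coe_eq {x : ℝ} {y : ℝ≥0∞} (h : ((x : ℝ) : EReal) = (y : ℝ≥0∞)) :
    x = y.toReal := by
  rw [← EReal.toReal_coe_ennreal, ← h, EReal.toReal_coe]

theorem ne_top_of_coe_eq {x : ℝ} {y : ℝ≥0∞} (h : ((x : ℝ) : EReal) = (y : ℝ≥0∞)) : y ≠ ⊤ := by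
  rintro rfl
  exact EReal.coe_ne_top x h

theorem surplus_eq (y : Fin (n + 1) → ℝ) :
    surplus y = ∑ i : Fin n, y i.castSucc + y (Fin.last n) := Fin.sum_univ_castSucc y

theorem bounds_of_mem_equilibriumPayoffs (hk : k ∈ Ioo 0 (priorMean F)) (hu : IsMcCall F k u)
    {y : Fin (n + 1) → ℝ} (hy : y ∈ equilibriumPayoffs F n k) :
    autarky F k ≤ y (Fin.last n) ∧ y (Fin.last n) ≤ surplus y ∧ surplus y ≤ u := by
  obtain ⟨σ, hσ, hb, ha⟩ := hy
  rw [hσ.agentPayoff_eq hk] at ha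
  have hu0 : 0 ≤ u := (sub_nonneg.2 hk.2.le).trans (autarky_le_of_isMcCall hk.1 hu)
  have h1 := hσ.agentValue_add_revenue_le hk hu 0 Fin.elim0
  have h2 := hσ.autarky_le_agentValue hk 0 Fin.elim0
  have hat := ne_top_of_coe_eq ha
  have hbt := fun i => ne_top_of_coe_eq (hb i)
  rw [surplus_eq]
  refine ⟨?_, le_add_of_nonneg_left (Finset.sum_nonneg fun i _ => ?_), ?_⟩
  · rw [eq_toReal_of_coe_eq ha]
    exact (ENNReal.ofReal_le_iff_le_toReal hat).1 h2
  · rw [eq_toReal_of_coe_eq (hb i)]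
    exact ENNReal.toReal_nonneg
  · rw [eq_toReal_of_coe_eq ha, Finset.sum_congr rfl fun i _ => eq_toReal_of_coe_eq (hb i),
      ← ENNReal.toReal_sum fun i _ => hbt i,
      ← ENNReal.toReal_add (ENNReal.sum_ne_top.2 fun i _ => hbt i) hat, add_comm]
    exact ENNReal.toReal_le_of_le_ofReal hu0 h1

/-- The agent gets at least a, the monopolist at least u - a, and together they get at most u: all
three bounds bind. -/
theorem eq_of_mem_equilibriumPayoffs_one (hk : k ∈ Ioo 0 (priorMean F)) (hu : IsMcCall F k u)
    (hthr : u < optionValue F (autarky F k)) {y : Fin 2 → ℝ} (hy : y ∈ equilibriumPayoffs F 1 k) :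
    y (Fin.last 1) = autarky F k ∧ surplus y = u := by
  obtain ⟨h1, -, h3⟩ := bounds_of_mem_equilibriumPayoffs hk hu hy
  obtain ⟨σ, hσ, hb, -⟩ := hy
  have h4 : u - autarky F k ≤ y (Fin.castSucc 0) := by
    rw [eq_toReal_of_coe_eq (hb 0)]
    exact (ENNReal.ofReal_le_iff_le_toReal (ne_top_of_coe_eq (hb 0))).1
      (hσ.le_brokerPayoff_of_threshold_lt hk hu hthr 0 Fin.elim0)
  rw [surplus_eq, Fin.sum_univ_one] at h3 ⊢
  constructor <;> linarith

theorem surplus_snoc (b : Fin n → ℝ) (a : ℝ) :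
    surplus (Fin.snoc (α := fun _ => ℝ) b a : Fin (n + 1) → ℝ) = ∑ i, b i + a := by
  simp [surplus_eq]

theorem surplusSet_eq_Icc (hk : k ∈ Ioo 0 (priorMean F)) (hu : IsMcCall F k u)
    (hthr : optionValue F (autarky F k) ≤ u) (hn : 1 ≤ n) :
    surplusSet (equilibriumPayoffs F n k) = Icc (autarky F k) u := by
  refine Subset.antisymm ?_ fun x hx => ⟨_, threat_mem hk hu hthr hn hx, ?_⟩
  · rintro _ ⟨y, hy, rfl⟩
    obtain ⟨h1, h2, h3⟩ := bounds_of_mem_equilibriumPayoffs hk hu hy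
    exact ⟨h1.trans h2, h3⟩
  · rw [surplus_snoc]; simp

theorem agentSet_eq_Icc (hk : k ∈ Ioo 0 (priorMean F)) (hu : IsMcCall F k u)
    (hthr : optionValue F (autarky F k) ≤ u) (hn : 1 ≤ n) :
    agentSet (equilibriumPayoffs F n k) = Icc (autarky F k) u := by
  refine Subset.antisymm ?_ fun x hx => ⟨_, threat_mem hk hu hthr hn hx, ?_⟩
  · rintro _ ⟨y, hy, rfl⟩
    obtain ⟨h1, h2, h3⟩ := bounds_of_mem_equilibriumPayoffs hk hu hy
    exact ⟨h1, h2.trans h3⟩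
  · simp

theorem surplusSet_one_eq_singleton (hk : k ∈ Ioo 0 (priorMean F)) (hu : IsMcCall F k u)
    (hthr : u < optionValue F (autarky F k)) :
    surplusSet (equilibriumPayoffs F 1 k) = {u} := by
  refine Subset.antisymm ?_ (singleton_subset_iff.2 ⟨_, monopoly_mem hk hu, ?_⟩)
  · rintro _ ⟨y, hy, rfl⟩
    exact (eq_of_mem_equilibriumPayoffs_one hk hu hthr hy).2
  · rw [surplus_snoc]; simp

theorem isLUB_surplusSet (hk : k ∈ Ioo 0 (priorMean F)) (hu : IsMcCall F k u) (hn : 1 ≤ n) :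
    IsLUB (surplusSet (equilibriumPayoffs F n k)) u := by
  have hmem : u ∈ surplusSet (equilibriumPayoffs F n k) := by
    rcases hn.eq_or_lt with rfl | hn
    · exact ⟨_, monopoly_mem hk hu, by rw [surplus_snoc]; simp⟩
    · exact ⟨_, competition_mem hk hu hn, by rw [surplus_snoc]; simp⟩
  refine ⟨?_, fun b hb => hb hmem⟩
  rintro _ ⟨y, hy, rfl⟩
  exact (bounds_of_mem_equilibriumPayoffs hk hu hy).2.2

end Payoffs

/-! ### Uniqueness of the threshold and the regulators' preferences -/

section Main

variable {F : Measure Theta} [IsProbabilityMeasure F]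

/-- `κ` separates the search costs for which refusing full information once, in order to obtain the
McCall payoff later, can be optimal. -/
def Separates (F : Measure Theta) (κ : ℝ) : Prop :=
  ∀ k ∈ Ioo 0 (priorMean F), ∀ u, IsMcCall F k u → (optionValue F (autarky F k) ≤ u ↔ k ≤ κ)

theorem Separates.isThreshold {κ : ℝ} (h : Separates F κ) (hκ : κ ∈ Ioo 0 (priorMean F)) :
    IsThreshold F κ := by
  refine ⟨hκ, fun n hn k hk => ?_⟩
  obtain ⟨u, hu⟩ := exists_isMcCall hk
  refine ⟨u, hu, fun hle => surplusSet_eq_Icc hk hu ((h k hk u hu).2 hle) hn, fun hlt =>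
    ⟨isLUB_surplusSet hk hu hn, ?_⟩⟩
  rw [surplusSet_one_eq_singleton hk hu (not_le.1 fun h' => hlt.not_ge ((h k hk u hu).1 h'))]
  exact isGLB_singleton

/-- At the threshold, a = μ - κ < μ ≤ Φ(a) ≤ u. -/
theorem Separates.autarky_lt {κ u : ℝ} (h : Separates F κ) (hκ : κ ∈ Ioo 0 (priorMean F))
    (hu : IsMcCall F κ u) : autarky F κ < u := by
  have h1 := (h κ hκ u hu).2 le_rfl
  have h2 := priorMean_le_optionValue (G := F) (autarky F κ)
  have : autarky F κ = priorMean F - κ := rfl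
  linarith [hκ.1]

theorem Separates.eq_of_isThreshold {κ κ' : ℝ} (h : Separates F κ) (hκ : κ ∈ Ioo 0 (priorMean F))
    (h' : IsThreshold F κ') : κ' = κ := by
  obtain ⟨hκ', hthr⟩ := h'
  rcases lt_trichotomy κ' κ with hlt | heq | hlt
  · obtain ⟨u, hu, -, h2⟩ := hthr 1 le_rfl κ hκ
    -- At κ the surpluses fill [a, u] with a < u, so their infimum cannot be u.
    have h3 := (h2 hlt).2
    rw [surplusSet_eq_Icc hκ hu ((h κ hκ u hu).2 le_rfl) le_rfl] at h3
    have hau := h.autarky_lt hκ hu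
    exact absurd (h3.unique (isGLB_Icc hau.le)) hau.ne'
  · exact heq
  · -- between the two thresholds, the autarky payoff equals the McCall payoff
    have key : ∀ k ∈ Ioc κ κ', optionValue F (autarky F k) - autarky F k - k = 0 := by
      intro k hk
      have hk' : k ∈ Ioo 0 (priorMean F) := ⟨hκ.1.trans hk.1, hk.2.trans_lt hκ'.2⟩
      obtain ⟨u, hu, h1, -⟩ := hthr 1 le_rfl k hk'
      have h2 := h1 hk.2
      have hlt' : u < optionValue F (autarky F k) :=
        not_le.1 fun h'' => hk.1.not_ge ((h k hk' u hu).1 h'')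
      rw [surplusSet_one_eq_singleton hk' hu hlt'] at h2
      have h3 : autarky F k ∈ ({u} : Set ℝ) := by
        rw [h2]; exact ⟨le_rfl, autarky_le_of_isMcCall hk'.1 hu⟩
      have h4 : autarky F k = u := h3
      have := isMcCall_iff.1 hu
      rw [h4, this]; ring
    have hcont : Continuous fun k => optionValue F (autarky F k) - autarky F k - k := by
      have := continuous_optionValue (G := F)
      unfold autarky
      fun_prop
    -- The equality a = u is only known for k above κ; continuity carries it to κ, where it fails.
    have hmem : κ ∈ closure (Ioc κ κ') := by
      rw [closure_Ioc hlt.ne]; exact ⟨le_rfl, hlt.le⟩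
    have h0 : optionValue F (autarky F κ) - autarky F κ - κ = 0 := by
      have hcl : IsClosed {k | optionValue F (autarky F k) - autarky F k - k = 0} :=
        isClosed_eq hcont continuous_const
      exact closure_minimal key hcl hmem
    have hu : IsMcCall F κ (autarky F κ) := isMcCall_iff.2 (by linarith)
    exact absurd (h.autarky_lt hκ hu) (lt_irrefl _)

end Main

end

end PersuadedSearch

open PersuadedSearch

theorem mainTheorem9 (F : MeasureTheory.Measure PersuadedSearch.Theta)
    [MeasureTheory.IsProbabilityMeasure F]
    (hF : F.AbsolutelyContinuous MeasureTheory.volume) :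
    (∃! kstar : ℝ, PersuadedSearch.IsThreshold F kstar) ∧
    ∀ kstar : ℝ, PersuadedSearch.IsThreshold F kstar → ∀ n : ℕ, 1 < n →
      -- a regulator that maximizes total surplus prefers monopoly
      (∀ y : (n : ℕ) → ℝ → Fin (n + 1) → ℝ, PersuadedSearch.IsSelectionRule F y →
        (∀ k ∈ Set.Ioo 0 (PersuadedSearch.priorMean F), kstar < k →
          PersuadedSearch.surplus (y n k) ≤ PersuadedSearch.surplus (y 1 k)) ∧
        (PersuadedSearch.WSymmetric F y →
          ∀ k ∈ Set.Ioo 0 (PersuadedSearch.priorMean F),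
            PersuadedSearch.surplus (y n k) ≤ PersuadedSearch.surplus (y 1 k))) ∧
      -- a regulator that maximizes the agent's payoff prefers competition
      (∀ y : (n : ℕ) → ℝ → Fin (n + 1) → ℝ, PersuadedSearch.IsSelectionRule F y →
        (∀ k ∈ Set.Ioo 0 (PersuadedSearch.priorMean F), kstar < k →
          y 1 k (Fin.last 1) ≤ y n k (Fin.last n)) ∧
        (PersuadedSearch.ASymmetric F y →
          ∀ k ∈ Set.Ioo 0 (PersuadedSearch.priorMean F),
            y 1 k (Fin.last 1) ≤ y n k (Fin.last n))) := by
  obtain ⟨κ, hκ, hsep : Separates F κ⟩ := exists_threshold hF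
  refine ⟨⟨κ, hsep.isThreshold hκ, fun κ' h' => hsep.eq_of_isThreshold hκ h'⟩,
    fun κ' h' n hn => ?_⟩
  obtain rfl := hsep.eq_of_isThreshold hκ h'
  have hthr : ∀ k ∈ Set.Ioo 0 (priorMean F), κ' < k → ∀ u, IsMcCall F k u →
      u < optionValue F (autarky F k) := fun k hk hlt u hu =>
    not_le.1 fun h => hlt.not_ge ((hsep k hk u hu).1 h)
  refine ⟨fun y hy => ?_, fun y hy => ?_⟩
  · have h1 : ∀ k ∈ Set.Ioo 0 (priorMean F), κ' < k → surplus (y n k) ≤ surplus (y 1 k) := by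
      intro k hk hlt
      obtain ⟨u, hu⟩ := exists_isMcCall hk
      rw [(eq_of_mem_equilibriumPayoffs_one hk hu (hthr k hk hlt u hu) (hy 1 le_rfl k hk)).2]
      exact (bounds_of_mem_equilibriumPayoffs hk hu (hy n hn.le k hk)).2.2
    refine ⟨h1, fun hsymm k hk => ?_⟩
    rcases le_or_gt k κ' with hle | hlt
    · obtain ⟨u, hu⟩ := exists_isMcCall hk
      have hle' := (hsep k hk u hu).2 hle
      -- Up to the threshold, both market structures have the same set of surpluses, so symmetry
      -- gives equality.
      refine (hsymm n 1 hn.le le_rfl k hk ?_).le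
      rw [surplusSet_eq_Icc hk hu hle' hn.le, surplusSet_eq_Icc hk hu hle' le_rfl]
    · exact h1 k hk hlt
  · have h1 : ∀ k ∈ Set.Ioo 0 (priorMean F), κ' < k →
        y 1 k (Fin.last 1) ≤ y n k (Fin.last n) := by
      intro k hk hlt
      obtain ⟨u, hu⟩ := exists_isMcCall hk
      rw [(eq_of_mem_equilibriumPayoffs_one hk hu (hthr k hk hlt u hu) (hy 1 le_rfl k hk)).1]
      exact (bounds_of_mem_equilibriumPayoffs hk hu (hy n hn.le k hk)).1
    refine ⟨h1, fun hsymm k hk => ?_⟩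
    rcases le_or_gt k κ' with hle | hlt
    · obtain ⟨u, hu⟩ := exists_isMcCall hk
      have hle' := (hsep k hk u hu).2 hle
      refine (hsymm 1 n le_rfl hn.le k hk ?_).le
      rw [agentSet_eq_Icc hk hu hle' le_rfl, agentSet_eq_Icc hk hu hle' hn.le]
    · exact h1 k hk hlt
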